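/- **Proposition.** Let $\Sigma$ be a finite alphabet and $L\subseteq\Sigma^*$. Then $L$ is generated by a right-linear indexed grammar with $k$ counters for some $k$ if and only if $L$ is accepted by an NPCM (that is, $\mathrm{IRLIN}_c=\mathrm{NPCM}$), where these notions are as follows. *Grammars.* An indexed grammar has finite, pairwise disjoint sets $V$, $\Sigma$, $I$ of nonterminals, terminals and indices, a start nonterminal $S\in V$, and a finite set of productions of the forms (1) $A\to\nu$, (2) $A\to Bf$, (3) $Af\to\nu$, with $A,B\in V$, $f\in I$, $\nu\in(V\cup\Sigma)^*$. Sentential forms are words in $(VI^*\cup\Sigma)^*$. For an occurrence of $A\alpha$ with $A \in V$, $\alpha\in I^*$ its full index word: (1) replaces $A\alpha$ by $\nu$ with $\alpha$ attached to every nonterminal of $\nu$; (2) replaces $A\alpha$ by $Bf\alpha$; (3) applies if $\alpha=f\alpha'$ and replaces $A\alpha$ by $\nu$ with $\alpha'$ attached to every nonterminal of $\nu$. In an indexed grammar with $k$ counters every production additionally carries a vector $(c_1,\dots,c_k)$ of nonnegative integers, which is added to the counter values $(n_1,\dots,n_k)$ whenever the production is applied; the grammar generates the set of all $u\in\Sigma^*$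 such that $(S,0,\dots,0)\Rightarrow^*(u,n_1,\dots,n_k)$ for some $n_1=\cdots=n_k$. It is right-linear if the right side of every production contains at most one nonterminal, and no terminal to the right of a nonterminal. *Machines.* An NPCM is a one-way nondeterministic pushdown automaton (with $\lambda$-moves, finitely many transitions, acceptance by final state after reading the whole input) augmented by finitely many counters holding nonnegative integers, initially $0$. A move may depend on which counters are zero, and adds $-1$, $0$ or $1$ to each counter (a zero counter cannot be decremented). Moreover, there must be an $l$ such that in every accepting computation each counter changes at most $l$ times between non-decreasing and non-increasing. -/

import Mathlib

universe u

/-! ### Indexed grammars -/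

/-- The three forms of productions of an indexed grammar with terminals `T`, nonterminals `V`
and indices `I`: `A → ν`, `A → B f` and `A f → ν`, where `ν ∈ (V ∪ T)*`. -/
inductive IndexedProduction (T V I : Type u) : Type u
  | rewrite (A : V) (ν : List (Symbol T V))
  | push (A B : V) (f : I)
  | pop (A : V) (f : I) (ν : List (Symbol T V))

/-- Sentential forms of an indexed grammar: words over terminals and over nonterminals carrying a
stack of indices (the head of the list is the index next to the nonterminal). -/
abbrev IndexedForm (T V I : Type u) : Type u := List (Symbol T (V × List I))

/-- Give the index stack `α` to a nonterminal; terminals stay as they are. -/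
def attachStack {T V I : Type u} (α : List I) : Symbol T V → Symbol T (V × List I)
  | .terminal a => .terminal a
  | .nonterminal B => .nonterminal (B, α)

namespace IndexedProduction

variable {T V I : Type u}

/-- The terminals and nonterminals on the right side of a production, in order. -/
def rhs : IndexedProduction T V I → List (Symbol T V)
  | .rewrite _ ν => ν
  | .push _ B _ => [.nonterminal B]
  | .pop _ _ ν => ν

/-- One application of a production to an occurrence of a nonterminal in a sentential form.
Every nonterminal of the right side inherits the (remaining) index stack. -/
inductive Rewrites : IndexedProduction T V I → IndexedForm T V I → IndexedForm T V I → Prop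
  | rewrite (A : V) (ν : List (Symbol T V)) (α : List I) (x y : IndexedForm T V I) :
      Rewrites (.rewrite A ν) (x ++ [.nonterminal (A, α)] ++ y) (x ++ ν.map (attachStack α) ++ y)
  | push (A B : V) (f : I) (α : List I) (x y : IndexedForm T V I) :
      Rewrites (.push A B f) (x ++ [.nonterminal (A, α)] ++ y)
        (x ++ [.nonterminal (B, f :: α)] ++ y)
  | pop (A : V) (f : I) (ν : List (Symbol T V)) (α : List I) (x y : IndexedForm T V I) :
      Rewrites (.pop A f ν) (x ++ [.nonterminal (A, f :: α)] ++ y)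
        (x ++ ν.map (attachStack α) ++ y)

end IndexedProduction

/-- An indexed grammar with terminals `T`, nonterminals `V`, indices `I` and finitely many
productions. (Finiteness of `T`, `V`, `I` is required where grammars are quantified over.) -/
structure IndexedGrammar (T V I : Type u) where
  /-- The start nonterminal. -/
  start : V
  /-- The productions. -/
  productions : Set (IndexedProduction T V I)
  /-- There are finitely many productions. -/
  finite_productions : productions.Finite

namespace IndexedGrammar

variable {T V I : Type u}

/-- The right side of every production has at most one occurrence of a nonterminal. -/
def IsLinear (G : IndexedGrammar T V I) : Prop :=
  ∀ p ∈ G.productions, ∀ (x y z : List (Symbol T V)) (B C : V),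
    p.rhs ≠ x ++ [.nonterminal B] ++ y ++ [.nonterminal C] ++ z

/-- The grammar is linear, and in no right side does a terminal occur to the right of a
nonterminal. -/
def IsRightLinear (G : IndexedGrammar T V I) : Prop :=
  G.IsLinear ∧ ∀ p ∈ G.productions, ∀ (x y z : List (Symbol T V)) (B : V) (a : T),
    p.rhs ≠ x ++ [.nonterminal B] ++ y ++ [.terminal a] ++ z

end IndexedGrammar

/-- An indexed grammar with `k` counters: every production `α → (β, c₁, …, c_k)` carries a vector
of nonnegative counter increments. -/
structure CounterIndexedGrammar (T V I : Type u) (k : ℕ) where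
  /-- The start nonterminal. -/
  start : V
  /-- The productions with their counter increments. -/
  productions : Set (IndexedProduction T V I × (Fin k → ℕ))
  /-- There are finitely many productions. -/
  finite_productions : productions.Finite

namespace CounterIndexedGrammar

variable {T V I : Type u} {k : ℕ}

/-- The underlying indexed grammar: drop the counter components from the productions. -/
def underlying (G : CounterIndexedGrammar T V I k) : IndexedGrammar T V I where
  start := G.start
  productions := Prod.fst '' G.productions
  finite_productions := G.finite_productions.image Prod.fst

/-- One derivation step `(ν, n₁, …, n_k) ⇒ (ν', n₁ + c₁, …, n_k + c_k)`. -/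
def Step (G : CounterIndexedGrammar T V I k) (s s' : IndexedForm T V I × (Fin k → ℕ)) : Prop :=
  ∃ p ∈ G.productions, p.1.Rewrites s.1 s'.1 ∧ s'.2 = s.2 + p.2

/-- The reflexive and transitive closure of `Step`. -/
def Derives (G : CounterIndexedGrammar T V I k) :
    IndexedForm T V I × (Fin k → ℕ) → IndexedForm T V I × (Fin k → ℕ) → Prop :=
  Relation.ReflTransGen G.Step

/-- The terminal words `u` with `(S, 0, …, 0) ⇒* (u, n₁, …, n_k)` and `n₁ = ⋯ = n_k`. -/
def language (G : CounterIndexedGrammar T V I k) : Language T :=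
  {u | ∃ n : Fin k → ℕ,
    G.Derives ([.nonterminal (G.start, [])], 0) (u.map .terminal, n) ∧ ∀ i j, n i = n j}

end CounterIndexedGrammar

/-- The family of languages generated by right-linear indexed grammars with counters. -/
def Language.IsRightLinearIndexedWithCounters {T : Type u} (L : Language T) : Prop :=
  ∃ (k : ℕ) (V I : Type u) (_ : Finite V) (_ : Finite I) (G : CounterIndexedGrammar T V I k),
    G.underlying.IsRightLinear ∧ G.language = L

/-! ### Pushdown automata with reversal-bounded counters -/

/-- A transition of a one-way nondeterministic pushdown automaton with `k` counters. It is
applicable in state `source` with `top` on top of the pushdown, when exactly the counters `i` with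
`isZero i = true` are zero; it reads a letter or nothing, replaces `top` by the word `push`
(leftmost symbol on top), adds `delta i ∈ {-1, 0, 1}` to counter `i`, and goes to `target`. -/
structure NPCMTransition (T Q Γ : Type u) (k : ℕ) where
  source : Q
  input : Option T
  top : Γ
  isZero : Fin k → Bool
  target : Q
  push : List Γ
  delta : Fin k → SignType

/-- A configuration: state, input still to be read, pushdown contents (head of the list on top)
and counter values. -/
structure NPCMConfig (T Q Γ : Type u) (k : ℕ) where
  state : Q
  input : List T
  stack : List Γ
  counters : Fin k → ℕ

/-- The transition `t` leads from `c` to `c'` in one step. A transition that decrements a counter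
whose value is zero, or that meets an empty pushdown, does not apply. -/
def NPCMTransition.Fires {T Q Γ : Type u} {k : ℕ} (t : NPCMTransition T Q Γ k)
    (c c' : NPCMConfig T Q Γ k) : Prop :=
  c.state = t.source ∧ c'.state = t.target ∧
  c.input = t.input.toList ++ c'.input ∧
  (∃ rest : List Γ, c.stack = t.top :: rest ∧ c'.stack = t.push ++ rest) ∧
  (∀ i, t.isZero i = true ↔ c.counters i = 0) ∧
  (∀ i, (c'.counters i : ℤ) = (c.counters i : ℤ) + ((t.delta i : SignType) : ℤ))

/-- The number of changes of direction in a sequence of counter moves, if `d` is the direction of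
the last move different from `0` that was made before (`d = 0` if there was none). Moves that
leave the counter unchanged are skipped. -/
def counterReversalsFrom : SignType → List SignType → ℕ
  | _, [] => 0
  | d, e :: l =>
      if e = 0 then counterReversalsFrom d l
      else if d = 0 ∨ e = d then counterReversalsFrom e l
      else counterReversalsFrom e l + 1

/-- The number of changes between non-decreasing and non-increasing in a sequence of counter
moves. -/
def counterReversals (l : List SignType) : ℕ := counterReversalsFrom 0 l

/-- A one-way nondeterministic pushdown automaton with input alphabet `T`, states `Q`, pushdown
alphabet `Γ` and `k` counters. -/
structure CounterPDA (T Q Γ : Type u) (k : ℕ) where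
  /-- The initial state. -/
  start : Q
  /-- The initial pushdown symbol. -/
  bottom : Γ
  /-- The final states. -/
  accept : Set Q
  /-- The transitions. -/
  transitions : Set (NPCMTransition T Q Γ k)
  /-- There are finitely many transitions. -/
  finite_transitions : transitions.Finite

namespace CounterPDA

variable {T Q Γ : Type u} {k : ℕ}

/-- The initial configuration on input `w`; all counters are zero. -/
def init (M : CounterPDA T Q Γ k) (w : List T) : NPCMConfig T Q Γ k where
  state := M.start
  input := w
  stack := [M.bottom]
  counters := 0

/-- `M.Computation c ts c'`: firing the transitions `ts` of `M` one after the other leads from `c`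
to `c'`. -/
inductive Computation (M : CounterPDA T Q Γ k) :
    NPCMConfig T Q Γ k → List (NPCMTransition T Q Γ k) → NPCMConfig T Q Γ k → Prop
  | nil (c : NPCMConfig T Q Γ k) : Computation M c [] c
  | cons {c c' c'' : NPCMConfig T Q Γ k} {t : NPCMTransition T Q Γ k}
      {ts : List (NPCMTransition T Q Γ k)} (ht : t ∈ M.transitions) (hf : t.Fires c c')
      (hc : Computation M c' ts c'') : Computation M c (t :: ts) c''

/-- `ts` is the sequence of transitions of an accepting computation on input `w`: it reads all of
`w` and ends in a final state. -/
def AcceptingComputation (M : CounterPDA T Q Γ k) (w : List T)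
    (ts : List (NPCMTransition T Q Γ k)) : Prop :=
  ∃ c, M.Computation (M.init w) ts c ∧ c.input = [] ∧ c.state ∈ M.accept

/-- The language accepted by `M` (by final state). -/
def language (M : CounterPDA T Q Γ k) : Language T :=
  {w | ∃ ts, M.AcceptingComputation w ts}

/-- `M` makes at most `l` reversals on each counter in every accepting computation. -/
def IsReversalBounded (M : CounterPDA T Q Γ k) (l : ℕ) : Prop :=
  ∀ w ts, M.AcceptingComputation w ts →
    ∀ i, counterReversals (ts.map fun t => t.delta i) ≤ l

end CounterPDA

/-- The family of languages accepted by pushdown automata with reversal-bounded counters. -/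
def Language.IsNPCM {T : Type u} (L : Language T) : Prop :=
  ∃ (k l : ℕ) (Q Γ : Type u) (_ : Finite Q) (_ : Finite Γ) (M : CounterPDA T Q Γ k),
    M.IsReversalBounded l ∧ M.language = L

/-! A derivation of a right-linear indexed grammar has one nonterminal, at the right end of the
sentential form. It is a run of a pushdown automaton: the nonterminal is the state, its index word
the pushdown, the terminals produced are the input (`Generates`, `mem_language_iff`). It remains to
trade counters that only grow and are compared once, at the end, for reversal-bounded counters with
zero tests.

From grammar to automaton (`simPDA`): make the increments of the productions, then decrement all
counters together. They can all be brought to zero in this way exactly when they were equal, and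
each counter reverses at most once.

From automaton to grammar (`checkGrammar`): the grammar guesses the zero tests of each counter and
has to verify the guesses. Along a stretch without increments the value is least at the end, so one
check after the last decrement is enough: the value there is zero (as many increments as decrements
so far) or positive (at least one increment more). Each check owns two grammar counters, which count
increments and decrements up to the check and are then frozen. Since a counter starts at zero, each
decreasing stretch begins with a reversal, so a bound on the reversals bounds the number of checks.
At the end all grammar counters are padded to a common value: a pair checked for zero is padded
equally, a pair checked for positivity may gain more on the decrement side, and a pair that was not
used is padded freely. Equality of all counters then verifies all checks. Soundness of the checks is
`CheckRun.validTrace`, completeness is `confirms_of_validTrace`. -/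

/-! ### Right-linear derivations as runs with a stack -/

namespace IndexedProduction

variable {T V I : Type u}

/-- The production applies to the nonterminal `A` with index stack `α`, and leaves the stack `β`
for the nonterminals of its right side. -/
inductive Applies : IndexedProduction T V I → V → List I → List I → Prop
  | rewrite (A : V) (ν : List (Symbol T V)) (α : List I) : Applies (.rewrite A ν) A α α
  | push (A B : V) (f : I) (α : List I) : Applies (.push A B f) A α (f :: α)
  | pop (A : V) (f : I) (ν : List (Symbol T V)) (α : List I) : Applies (.pop A f ν) A (f :: α) α

/-- Separates the effect on the index stack from the right side, so that the three forms of
productions can be treated alike. -/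
theorem rewrites_iff {p : IndexedProduction T V I} {s s' : IndexedForm T V I} :
    p.Rewrites s s' ↔ ∃ x y A α β, p.Applies A α β ∧ s = x ++ [.nonterminal (A, α)] ++ y ∧
      s' = x ++ p.rhs.map (attachStack β) ++ y := by
  constructor
  · rintro (⟨A, ν, α, x, y⟩ | ⟨A, B, f, α, x, y⟩ | ⟨A, f, ν, α, x, y⟩)
    · exact ⟨x, y, A, α, α, .rewrite A ν α, rfl, rfl⟩
    · exact ⟨x, y, A, α, f :: α, .push A B f α, rfl, rfl⟩
    · exact ⟨x, y, A, f :: α, α, .pop A f ν α, rfl, rfl⟩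
  · rintro ⟨x, y, A, α, β, h, rfl, rfl⟩
    cases h with
    | rewrite A ν => exact .rewrite A ν α x y
    | push A B f => exact .push A B f α x y
    | pop A f ν => exact .pop A f ν β x y

end IndexedProduction

/-- A terminal word followed by at most one nonterminal. -/
def rightLinearWord {T V : Type u} (w : List T) (o : Option V) : List (Symbol T V) :=
  w.map .terminal ++ o.toList.map .nonterminal

theorem exists_eq_rightLinearWord {T V : Type u} (ν : List (Symbol T V))
    (h₁ : ∀ (x y z : List (Symbol T V)) (B C : V),
      ν ≠ x ++ [.nonterminal B] ++ y ++ [.nonterminal C] ++ z)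
    (h₂ : ∀ (x y z : List (Symbol T V)) (B : V) (a : T),
      ν ≠ x ++ [.nonterminal B] ++ y ++ [.terminal a] ++ z) :
    ∃ w o, ν = rightLinearWord w o := by
  induction ν with
  | nil => exact ⟨[], none, rfl⟩
  | cons s ν ih =>
    cases s with
    | terminal a =>
      obtain ⟨w, o, rfl⟩ := ih
        (fun x y z B C h => h₁ (.terminal a :: x) y z B C (by simp [h]))
        (fun x y z B b h => h₂ (.terminal a :: x) y z B b (by simp [h]))
      exact ⟨a :: w, o, rfl⟩
    | nonterminal B =>
      cases ν with
      | nil => exact ⟨[], some B, rfl⟩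
      | cons s' ν =>
        cases s' with
        | terminal a => exact absurd rfl (h₂ [] [] ν B a)
        | nonterminal C => exact absurd rfl (h₁ [] [] ν B C)

theorem rightLinearWord_ne_linear {T V : Type u} (w : List T) (o : Option V)
    (x y z : List (Symbol T V)) (B C : V) :
    rightLinearWord w o ≠ x ++ [.nonterminal B] ++ y ++ [.nonterminal C] ++ z := by
  induction w generalizing x with
  | nil => cases o <;> cases x <;> simp [rightLinearWord]
  | cons a w ih =>
    intro h
    cases x with
    | nil => simp [rightLinearWord] at h
    | cons s x =>
      refine ih x ?_
      simp only [rightLinearWord, List.map_cons, List.cons_append, List.cons.injEq] at h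
      exact h.2

theorem rightLinearWord_ne_right {T V : Type u} (w : List T) (o : Option V)
    (x y z : List (Symbol T V)) (B : V) (a : T) :
    rightLinearWord w o ≠ x ++ [.nonterminal B] ++ y ++ [.terminal a] ++ z := by
  induction w generalizing x with
  | nil => cases o <;> cases x <;> simp [rightLinearWord]
  | cons a w ih =>
    intro h
    cases x with
    | nil => simp [rightLinearWord] at h
    | cons s x =>
      refine ih x ?_
      simp only [rightLinearWord, List.map_cons, List.cons_append, List.cons.injEq] at h
      exact h.2

theorem map_terminal_ne_append_nonterminal {T V : Type u} (w : List T) (x y : List (Symbol T V))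
    (B : V) : w.map .terminal ≠ x ++ [.nonterminal B] ++ y := by
  intro h
  have : (.nonterminal B : Symbol T V) ∈ w.map .terminal := by rw [h]; simp
  simp at this

theorem terminal_append_nonterminal_inj {T V : Type u} {w : List T} {x y : List (Symbol T V)}
    {A B : V} (h : w.map .terminal ++ [.nonterminal A] = x ++ [.nonterminal B] ++ y) :
    x = w.map .terminal ∧ A = B ∧ y = [] := by
  induction w generalizing x with
  | nil => cases x <;> simp_all
  | cons a w ih =>
    cases x with
    | nil => simp at h
    | cons s x =>
      simp only [List.map_cons, List.cons_append, List.cons.injEq] at h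
      obtain ⟨rfl, h⟩ := h
      obtain ⟨rfl, rfl, rfl⟩ := ih h
      exact ⟨rfl, rfl, rfl⟩

theorem map_attachStack_rightLinearWord {T V I : Type u} (w : List T) (o : Option V)
    (β : List I) : (rightLinearWord w o).map (attachStack β) =
      rightLinearWord w (o.map fun B => (B, β)) := by
  cases o <;> simp [rightLinearWord, attachStack, Function.comp_def]

namespace CounterIndexedGrammar

variable {T V I : Type u} {k : ℕ}

theorem underlying_isRightLinear_iff (G : CounterIndexedGrammar T V I k) :
    G.underlying.IsRightLinear ↔ ∀ p ∈ G.productions, ∃ w o, p.1.rhs = rightLinearWord w o := by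
  constructor
  · intro h p hp
    have hp' : p.1 ∈ G.underlying.productions := ⟨p, hp, rfl⟩
    exact exists_eq_rightLinearWord _ (h.1 _ hp') (h.2 _ hp')
  · intro h
    constructor
    · rintro _ ⟨p, hp, rfl⟩
      obtain ⟨w, o, e⟩ := h p hp
      rw [e]
      exact rightLinearWord_ne_linear w o
    · rintro _ ⟨p, hp, rfl⟩
      obtain ⟨w, o, e⟩ := h p hp
      rw [e]
      exact rightLinearWord_ne_right w o

/-- Derivations of a right-linear grammar, viewed as runs of a pushdown machine:
`G.Generates A α n u n'` says that the nonterminal `A` with index stack `α` derives the terminal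
word `u`, where the counters change from `n` to `n'`. -/
inductive Generates (G : CounterIndexedGrammar T V I k) :
    V → List I → (Fin k → ℕ) → List T → (Fin k → ℕ) → Prop
  | halt {A : V} {α β : List I} {n : Fin k → ℕ} {p : IndexedProduction T V I × (Fin k → ℕ)}
      {w : List T} (hp : p ∈ G.productions) (ha : p.1.Applies A α β)
      (hr : p.1.rhs = rightLinearWord w none) : Generates G A α n w (n + p.2)
  | step {A B : V} {α β : List I} {n n' : Fin k → ℕ}
      {p : IndexedProduction T V I × (Fin k → ℕ)} {w u : List T} (hp : p ∈ G.productions)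
      (ha : p.1.Applies A α β) (hr : p.1.rhs = rightLinearWord w (some B))
      (h : Generates G B β (n + p.2) u n') : Generates G A α n (w ++ u) n'

theorem Generates.derives {G : CounterIndexedGrammar T V I k} {A : V} {α : List I}
    {n n' : Fin k → ℕ} {u : List T} (h : G.Generates A α n u n') (x : List T) :
    G.Derives (x.map .terminal ++ [.nonterminal (A, α)], n) ((x ++ u).map .terminal, n') := by
  induction h generalizing x with
  | @halt A α β n p w hp ha hr =>
    refine .single ⟨p, hp, IndexedProduction.rewrites_iff.2
      ⟨x.map .terminal, [], A, α, β, ha, by simp, ?_⟩, rfl⟩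
    rw [hr, map_attachStack_rightLinearWord]
    simp [rightLinearWord]
  | @step A B α β n n' p w u hp ha hr _ ih =>
    refine .head (b := ((x ++ w).map .terminal ++ [.nonterminal (B, β)], n + p.2))
      ⟨p, hp, IndexedProduction.rewrites_iff.2
        ⟨x.map .terminal, [], A, α, β, ha, by simp, ?_⟩, rfl⟩ ?_
    · rw [hr, map_attachStack_rightLinearWord]
      simp [rightLinearWord]
    · simpa [Derives] using ih (x ++ w)

/-- Right-linearity keeps the form "terminal word, then one nonterminal" until a production without
nonterminal is applied; after that no step is possible. -/
theorem Derives.generates {G : CounterIndexedGrammar T V I k} (hG : G.underlying.IsRightLinear)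
    {s : IndexedForm T V I × (Fin k → ℕ)} {u : List T} {n' : Fin k → ℕ}
    (h : G.Derives s (u.map .terminal, n')) (x : List T) (A : V) (α : List I)
    (hs : s.1 = x.map .terminal ++ [.nonterminal (A, α)]) :
    ∃ v, u = x ++ v ∧ G.Generates A α s.2 v n' := by
  have hG' := G.underlying_isRightLinear_iff.1 hG
  induction h using Relation.ReflTransGen.head_induction_on generalizing x A α with
  | refl => exact absurd (by simpa using hs) (map_terminal_ne_append_nonterminal u _ [] _)
  | @head s s' hstep hrest ih =>
    obtain ⟨p, hp, hrew, hc⟩ := hstep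
    obtain ⟨x', y, A', α', β, ha, e, e'⟩ := IndexedProduction.rewrites_iff.1 hrew
    obtain ⟨rfl, hA, rfl⟩ := terminal_append_nonterminal_inj (hs.symm.trans e)
    obtain ⟨rfl, rfl⟩ := Prod.mk.inj hA
    obtain ⟨w, o, hr⟩ := hG' p hp
    rw [hr, map_attachStack_rightLinearWord] at e'
    cases o with
    | none =>
      have e'' : s'.1 = (x ++ w).map .terminal := by rw [e']; simp [rightLinearWord]
      cases hrest using Relation.ReflTransGen.head_induction_on with
      | refl =>
        refine ⟨w, ?_, ?_⟩
        · exact List.map_injective_iff.2 (fun a b h => Symbol.terminal.inj h) e''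
        · rw [show n' = s.2 + p.2 from hc]
          exact .halt hp ha hr
      | head hstep' =>
        obtain ⟨p', -, hrew', -⟩ := hstep'
        obtain ⟨x'', y', A'', α'', -, -, e3, -⟩ := IndexedProduction.rewrites_iff.1 hrew'
        exact absurd (e''.symm.trans e3) (map_terminal_ne_append_nonterminal _ _ _ _)
    | some B =>
      obtain ⟨v, rfl, hv⟩ := ih (x ++ w) B β (by rw [e']; simp [rightLinearWord])
      exact ⟨w ++ v, by simp, .step hp ha hr (hc ▸ hv)⟩

theorem mem_language_iff {G : CounterIndexedGrammar T V I k} (hG : G.underlying.IsRightLinear)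
    {u : List T} : u ∈ G.language ↔
      ∃ n : Fin k → ℕ, G.Generates G.start [] 0 u n ∧ ∀ i j, n i = n j := by
  constructor
  · rintro ⟨n, h, hn⟩
    obtain ⟨v, rfl, hv⟩ := Derives.generates hG h [] G.start [] rfl
    exact ⟨n, hv, hn⟩
  · rintro ⟨n, h, hn⟩
    exact ⟨n, by simpa using h.derives [], hn⟩

end CounterIndexedGrammar

/-! ### Finiteness of transition sets, and counting reversals -/

theorem NPCMTransition.finite_setOf_length_push_le {T Q Γ : Type u} [Finite T] [Finite Q]
    [Finite Γ] (k N : ℕ) : {t : NPCMTransition T Q Γ k | t.push.length ≤ N}.Finite := by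
  have h : Finite {l : List Γ // l.length ≤ N} := List.finite_length_le Γ N
  refine (Set.finite_range fun x : Q × Option T × Γ × (Fin k → Bool) × Q ×
    {l : List Γ // l.length ≤ N} × (Fin k → SignType) =>
      (⟨x.1, x.2.1, x.2.2.1, x.2.2.2.1, x.2.2.2.2.1, x.2.2.2.2.2.1.1, x.2.2.2.2.2.2⟩ :
        NPCMTransition T Q Γ k)).subset ?_
  intro t ht
  exact ⟨(t.source, t.input, t.top, t.isZero, t.target, ⟨t.push, ht⟩, t.delta), rfl⟩

theorem counterReversalsFrom_of_nonpos {l : List SignType} (hl : ∀ e ∈ l, e ≤ 0) {d : SignType}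
    (hd : d ≤ 0) : counterReversalsFrom d l = 0 := by
  induction l generalizing d with
  | nil => rfl
  | cons e l ih =>
    have he := hl e (by simp)
    have hl' : ∀ e ∈ l, e ≤ 0 := fun e h => hl e (by simp [h])
    have h0 := ih hl' hd
    have h1 := ih hl' he
    rw [counterReversalsFrom, h0, h1]
    cases d <;> cases e <;> simp_all

theorem counterReversalsFrom_le_one_of_nonpos {l : List SignType} (hl : ∀ e ∈ l, e ≤ 0)
    (d : SignType) : counterReversalsFrom d l ≤ 1 := by
  induction l generalizing d with
  | nil => simp [counterReversalsFrom]
  | cons e l ih =>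
    have hl' : ∀ e ∈ l, e ≤ 0 := fun e h => hl e (by simp [h])
    rw [counterReversalsFrom, counterReversalsFrom_of_nonpos hl' (hl e (by simp))]
    split_ifs
    · exact ih hl' d
    · simp
    · simp

theorem counterReversalsFrom_cons_of_nonneg {l : List SignType} {d e : SignType} (hd : 0 ≤ d)
    (he : 0 ≤ e) : ∃ d', 0 ≤ d' ∧
      counterReversalsFrom d (e :: l) = counterReversalsFrom d' l := by
  by_cases h : e = 0
  · exact ⟨d, hd, by simp [counterReversalsFrom, h]⟩
  · refine ⟨e, he, ?_⟩
    have : d = 0 ∨ e = d := by revert d e; decide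
    simp [counterReversalsFrom, h, this]

namespace CounterPDA

variable {T Q Γ : Type u} {k : ℕ}

/-- Some computation from the configuration reads the whole input and ends in a final state. -/
def Accepts (M : CounterPDA T Q Γ k) (c : NPCMConfig T Q Γ k) : Prop :=
  ∃ ts c', M.Computation c ts c' ∧ c'.input = [] ∧ c'.state ∈ M.accept

theorem Accepts.cons {M : CounterPDA T Q Γ k} {c c' : NPCMConfig T Q Γ k}
    {t : NPCMTransition T Q Γ k} (ht : t ∈ M.transitions) (hf : t.Fires c c')
    (h : M.Accepts c') : M.Accepts c := by
  obtain ⟨ts, c'', hc, h⟩ := h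
  exact ⟨t :: ts, c'', .cons ht hf hc, h⟩

theorem mem_language_iff_accepts {M : CounterPDA T Q Γ k} {w : List T} :
    w ∈ M.language ↔ M.Accepts (M.init w) := Iff.rfl

end CounterPDA

/-! ### From grammars to automata -/

namespace CounterIndexedGrammar

variable {T V I : Type u} {k : ℕ}

/-- The effect of a production on a pushdown over `Option I` with bottom symbol `none`. -/
inductive PushdownEffect :
    IndexedProduction T V I → V → Option I → List (Option I) → Prop
  | rewrite (A : V) (ν : List (Symbol T V)) (g : Option I) :
      PushdownEffect (.rewrite A ν) A g [g]
  | push (A B : V) (f : I) (g : Option I) : PushdownEffect (.push A B f) A g [some f, g]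
  | pop (A : V) (f : I) (ν : List (Symbol T V)) : PushdownEffect (.pop A f ν) A (some f) []

/-- The pushdown that represents an index stack. -/
def pushdown (α : List I) : List (Option I) := α.map some ++ [none]

theorem pushdown_ne_nil (α : List I) : pushdown α ≠ [] := by simp [pushdown]

/-- The bottom symbol `none` is never popped, so every move finds a top symbol even when the index
stack is empty. -/
theorem PushdownEffect.applies {p : IndexedProduction T V I} {A : V} {g : Option I}
    {γ rest : List (Option I)} {α : List I} (h : PushdownEffect p A g γ)
    (hα : g :: rest = pushdown α) : ∃ β, γ ++ rest = pushdown β ∧ p.Applies A α β := by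
  cases h with
  | rewrite A ν g => exact ⟨α, hα, .rewrite A ν α⟩
  | push A B f g => exact ⟨f :: α, by simpa [pushdown] using hα, .push A B f α⟩
  | pop A f ν =>
    cases α with
    | nil => simp [pushdown] at hα
    | cons f' α =>
      simp only [pushdown, List.map_cons, List.cons_append, List.cons.injEq,
        Option.some.injEq] at hα
      obtain ⟨rfl, hα⟩ := hα
      exact ⟨α, hα, .pop A f ν α⟩

theorem exists_pushdownEffect {p : IndexedProduction T V I} {A : V} {α β : List I}
    (h : p.Applies A α β) : ∃ g γ rest, PushdownEffect p A g γ ∧ pushdown α = g :: rest ∧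
      pushdown β = γ ++ rest := by
  cases h with
  | rewrite A ν α =>
    obtain ⟨g, rest, h⟩ := List.exists_cons_of_ne_nil (pushdown_ne_nil α)
    exact ⟨g, [g], rest, .rewrite A ν g, h, h⟩
  | push A B f α =>
    obtain ⟨g, rest, h⟩ := List.exists_cons_of_ne_nil (pushdown_ne_nil α)
    exact ⟨g, [some f, g], rest, .push A B f g, h, by simpa [pushdown] using h⟩
  | pop A f ν β => exact ⟨some f, [], pushdown β, .pop A f ν, rfl, rfl⟩

/-- A state of the simulating automaton: the terminals that have yet to be read, the counter
increments that have yet to be made, and the nonterminal to go on with. -/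
abbrev Job (T V : Type u) (k : ℕ) : Type u := List T × (Fin k → ℕ) × Option V

/-- The moves of the simulating automaton. The state `none` is final. -/
inductive SimMove (G : CounterIndexedGrammar T V I k) :
    Option (Job T V k) → Option T → Option I → (Fin k → Bool) → Option (Job T V k) →
      List (Option I) → (Fin k → SignType) → Prop
  | tick {w w' : List T} {c c' : Fin k → ℕ} {o : Option V} {x : Option T} {g : Option I}
      {z : Fin k → Bool} {δ : Fin k → SignType} (hw : w = x.toList ++ w')
      (hc : ∀ i, (c i : ℤ) = c' i + ((δ i : SignType) : ℤ)) (hδ : ∀ i, 0 ≤ δ i) :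
      SimMove G (some (w, c, o)) x g z (some (w', c', o)) [g] δ
  | produce {A : V} {p : IndexedProduction T V I × (Fin k → ℕ)} {w : List T} {o : Option V}
      {g : Option I} {γ : List (Option I)} {z : Fin k → Bool} (hp : p ∈ G.productions)
      (he : PushdownEffect p.1 A g γ) (hr : p.1.rhs = rightLinearWord w o) :
      SimMove G (some ([], 0, some A)) none g z (some (w, p.2, o)) γ 0
  | decrease {g : Option I} {z : Fin k → Bool} :
      SimMove G (some ([], 0, none)) none g z (some ([], 0, none)) [g] (fun _ => -1)
  | finish {g : Option I} : SimMove G (some ([], 0, none)) none g (fun _ => true) none [g] 0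

theorem SimMove.length_le {G : CounterIndexedGrammar T V I k} {s s' : Option (Job T V k)}
    {x : Option T} {g : Option I} {z : Fin k → Bool} {γ : List (Option I)}
    {δ : Fin k → SignType} (h : SimMove G s x g z s' γ δ) : γ.length ≤ 2 := by
  cases h with
  | @produce A p w o g γ z hp he hr =>
    generalize p.1 = q at he
    cases he <;> simp
  | _ => simp

/-- What it means for a configuration to be accepting, in terms of the grammar. -/
def SimAccepts (G : CounterIndexedGrammar T V I k) :
    Option (Job T V k) → List T → List (Option I) → (Fin k → ℕ) → Prop
  | none, u, _, _ => u = []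
  | some (w, c, none), u, _, n => u = w ∧ ∀ i j, n i + c i = n j + c j
  | some (w, c, some A), u, γ, n => ∀ α, γ = pushdown α → ∃ u' n', u = w ++ u' ∧
      G.Generates A α (n + c) u' n' ∧ ∀ i j, n' i = n' j

/-- Soundness, propagated backwards along a computation. A `tick` preserves the sum of the counters
and the pending increments, `decrease` preserves the differences of the counters, and `finish`
requires all counters to be zero, hence equal. -/
theorem SimMove.simAccepts {G : CounterIndexedGrammar T V I k} {s s' : Option (Job T V k)}
    {x : Option T} {g : Option I} {z : Fin k → Bool} {γ : List (Option I)}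
    {δ : Fin k → SignType} (h : SimMove G s x g z s' γ δ) {u : List T} {rest : List (Option I)}
    {n n' : Fin k → ℕ} (hz : ∀ i, z i = true ↔ n i = 0)
    (hn : ∀ i, (n' i : ℤ) = n i + ((δ i : SignType) : ℤ))
    (hs : SimAccepts G s' u (γ ++ rest) n') : SimAccepts G s (x.toList ++ u) (g :: rest) n := by
  cases h with
  | @tick w w' c c' o x g z δ hw hc hδ =>
    have e : ∀ i, n' i + c' i = n i + c i := fun i => by have := hc i; have := hn i; omega
    cases o with
    | none =>
      obtain ⟨rfl, hs⟩ := hs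
      refine ⟨hw.symm, fun i j => ?_⟩
      rw [← e, ← e]
      exact hs i j
    | some A =>
      intro α hα
      obtain ⟨u', n'', rfl, hg, hs⟩ := hs α hα
      rw [show n' + c' = n + c from funext e] at hg
      exact ⟨u', n'', by simp [hw], hg, hs⟩
  | @produce A p w o g γ z hp he hr =>
    obtain rfl : n' = n := funext fun i => by simpa using hn i
    intro α hα
    obtain ⟨β, hβ, ha⟩ := he.applies hα
    cases o with
    | none =>
      obtain ⟨rfl, hs⟩ := hs
      exact ⟨u, n' + p.2, rfl, by simpa using Generates.halt hp ha hr, hs⟩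
    | some B =>
      obtain ⟨u', n'', rfl, hg, hs⟩ := hs β hβ
      exact ⟨w ++ u', n'', rfl, .step hp ha hr (by simpa using hg), hs⟩
  | decrease =>
    obtain ⟨rfl, hs⟩ := hs
    refine ⟨rfl, fun i j => ?_⟩
    have h1 := hn i
    have h2 := hn j
    have h3 := hs i j
    simp at h1 h2 h3 ⊢
    omega
  | finish =>
    obtain rfl : u = [] := hs
    refine ⟨rfl, fun i j => ?_⟩
    simp [(hz i).1 rfl, (hz j).1 rfl]

/-- The states from which no counter is increased. -/
def IsFinalPhase (s : Option (Job T V k)) : Prop := s = none ∨ s = some ([], 0, none)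

/-- The final phase is never left: with nothing pending, a `tick` can only idle. Together with
`SimMove.nonneg` this gives the bound of one reversal. -/
theorem SimMove.nonpos {G : CounterIndexedGrammar T V I k} {s s' : Option (Job T V k)}
    {x : Option T} {g : Option I} {z : Fin k → Bool} {γ : List (Option I)}
    {δ : Fin k → SignType} (h : SimMove G s x g z s' γ δ) (hs : IsFinalPhase s) :
    IsFinalPhase s' ∧ ∀ i, δ i ≤ 0 := by
  cases h with
  | @tick w w' c c' o x g z δ hw hc hδ =>
    simp only [IsFinalPhase, reduceCtorEq, Option.some.injEq, Prod.mk.injEq, false_or] at hs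
    obtain ⟨rfl, rfl, rfl⟩ := hs
    have hw' : w' = [] := by simp_all
    have key : ∀ i, c' i = 0 ∧ δ i = 0 := by
      intro i
      have h1 := hc i
      have h2 := hδ i
      revert h1 h2
      cases δ i <;> simp <;> omega
    refine ⟨.inr ?_, fun i => (key i).2.le⟩
    rw [hw', show c' = 0 from funext fun i => (key i).1]
  | produce => simp [IsFinalPhase] at hs
  | decrease => exact ⟨.inr rfl, fun i => show (-1 : SignType) ≤ 0 by decide⟩
  | finish => exact ⟨.inl rfl, fun i => le_rfl⟩

theorem SimMove.nonneg {G : CounterIndexedGrammar T V I k} {s s' : Option (Job T V k)}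
    {x : Option T} {g : Option I} {z : Fin k → Bool} {γ : List (Option I)}
    {δ : Fin k → SignType} (h : SimMove G s x g z s' γ δ) (hs : ¬ IsFinalPhase s) (i : Fin k) :
    0 ≤ δ i := by
  cases h with
  | tick hw hc hδ => exact hδ i
  | produce => exact le_rfl
  | decrease => exact absurd (.inr rfl) hs
  | finish => exact le_rfl

/-- The jobs of size at most `N`. -/
def BoundedJob (N : ℕ) (s : Job T V k) : Prop := s.1.length ≤ N ∧ ∀ i, s.2.1 i ≤ N

theorem finite_boundedJob [Finite T] [Finite V] (N : ℕ) :
    Finite {s : Job T V k // BoundedJob N s} := by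
  have h : Finite {l : List T // l.length ≤ N} := List.finite_length_le T N
  refine Finite.of_injective (β := {l : List T // l.length ≤ N} × (Fin k → Fin (N + 1)) × Option V)
    (fun s => (⟨s.1.1, s.2.1⟩, fun i => ⟨s.1.2.1 i, Nat.lt_succ_of_le (s.2.2 i)⟩, s.1.2.2)) ?_
  rintro ⟨⟨w, c, o⟩, h⟩ ⟨⟨w', c', o'⟩, h'⟩ e
  simp only [Prod.mk.injEq, Subtype.mk.injEq] at e ⊢
  exact ⟨e.1, funext fun i => by simpa using congrFun e.2.1 i, e.2.2⟩

/-- The automaton with counters that simulates a right-linear indexed grammar with counters. -/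
def simPDA [Finite T] [Finite V] [Finite I] (G : CounterIndexedGrammar T V I k) (N : ℕ) :
    CounterPDA T (Option {s : Job T V k // BoundedJob N s}) (Option I) k where
  start := some ⟨([], 0, some G.start), by simp [BoundedJob]⟩
  bottom := none
  accept := {none}
  transitions := {t | SimMove G (t.source.map Subtype.val) t.input t.top t.isZero
    (t.target.map Subtype.val) t.push t.delta}
  finite_transitions :=
    have := finite_boundedJob (T := T) (V := V) (k := k) N
    (NPCMTransition.finite_setOf_length_push_le k 2).subset fun _ h => h.length_le

section Simulation

variable [Finite T] [Finite V] [Finite I] {G : CounterIndexedGrammar T V I k} {N : ℕ}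

theorem simAccepts_of_computation
    {c c' : NPCMConfig T (Option {s : Job T V k // BoundedJob N s}) (Option I) k}
    {ts : List (NPCMTransition T _ (Option I) k)} (h : (G.simPDA N).Computation c ts c')
    (hi : c'.input = []) (hs : c'.state = none) :
    SimAccepts G (c.state.map Subtype.val) c.input c.stack c.counters := by
  induction h with
  | nil c => rw [hs]; exact hi
  | cons ht hf _ ih =>
    obtain ⟨h1, h2, h3, ⟨rest, h4, h5⟩, h6, h7⟩ := hf
    rw [h1, h3, h4]
    refine SimMove.simAccepts ht h6 h7 ?_
    rw [← h2, ← h5]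
    exact ih hi hs

theorem nonpos_of_computation
    {c c' : NPCMConfig T (Option {s : Job T V k // BoundedJob N s}) (Option I) k}
    {ts : List (NPCMTransition T _ (Option I) k)} (h : (G.simPDA N).Computation c ts c')
    (hs : IsFinalPhase (c.state.map Subtype.val)) (i : Fin k) :
    ∀ e ∈ ts.map fun t => t.delta i, e ≤ 0 := by
  induction h with
  | nil c => simp
  | cons ht hf _ ih =>
    rw [hf.1] at hs
    obtain ⟨h1, h2⟩ := SimMove.nonpos ht hs
    rw [← hf.2.1] at h1
    simp only [List.map_cons, List.mem_cons, forall_eq_or_imp]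
    exact ⟨h2 i, ih h1⟩

theorem counterReversalsFrom_le_one_of_computation
    {c c' : NPCMConfig T (Option {s : Job T V k // BoundedJob N s}) (Option I) k}
    {ts : List (NPCMTransition T _ (Option I) k)} (h : (G.simPDA N).Computation c ts c')
    (i : Fin k) {d : SignType} (hd : 0 ≤ d) :
    counterReversalsFrom d (ts.map fun t => t.delta i) ≤ 1 := by
  by_cases hs : IsFinalPhase (c.state.map Subtype.val)
  · exact counterReversalsFrom_le_one_of_nonpos (nonpos_of_computation h hs i) d
  induction h generalizing d with
  | nil c => simp [counterReversalsFrom]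
  | @cons c c1 c2 t ts ht hf hc ih =>
    rw [hf.1] at hs
    obtain ⟨d', hd', e⟩ := counterReversalsFrom_cons_of_nonneg
      (l := ts.map fun t => t.delta i) hd (SimMove.nonneg ht hs i)
    rw [List.map_cons, e]
    by_cases hs' : IsFinalPhase (c1.state.map Subtype.val)
    · exact counterReversalsFrom_le_one_of_nonpos (nonpos_of_computation hc hs' i) d'
    · exact ih hd' hs'

theorem SimMove.accepts {s s' : Option {s : Job T V k // BoundedJob N s}}
    {x : Option T} {g : Option I} {z : Fin k → Bool} {γ : List (Option I)}
    {δ : Fin k → SignType}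
    (h : SimMove G (s.map Subtype.val) x g z (s'.map Subtype.val) γ δ) {u : List T}
    {rest : List (Option I)} {n n' : Fin k → ℕ} (hz : ∀ i, z i = true ↔ n i = 0)
    (hn : ∀ i, (n' i : ℤ) = n i + ((δ i : SignType) : ℤ))
    (hs : (G.simPDA N).Accepts ⟨s', u, γ ++ rest, n'⟩) :
    (G.simPDA N).Accepts ⟨s, x.toList ++ u, g :: rest, n⟩ :=
  hs.cons (t := ⟨s, x, g, z, s', γ, δ⟩) h ⟨rfl, rfl, rfl, ⟨rest, rfl, rfl⟩, hz, hn⟩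

/-- A job is worked off in at most `m` ticks: each reads the next pending letter, if any, and
increments every counter that still has a pending increment. -/
theorem accepts_tick (m : ℕ) {w u : List T} {c n : Fin k → ℕ} {o : Option V}
    {γ : List (Option I)} (hγ : γ ≠ []) (hw : w.length ≤ m) (hc : ∀ i, c i ≤ m)
    (hb : BoundedJob N (w, c, o)) (h : (G.simPDA N).Accepts
      ⟨some ⟨([], 0, o), by simp [BoundedJob]⟩, u, γ, n + c⟩) :
    (G.simPDA N).Accepts ⟨some ⟨(w, c, o), hb⟩, w ++ u, γ, n⟩ := by
  induction m generalizing w c n with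
  | zero =>
    obtain rfl : w = [] := by simpa using hw
    obtain rfl : c = 0 := funext fun i => by simpa using hc i
    simpa using h
  | succ m ih =>
    obtain ⟨g, rest, rfl⟩ := List.exists_cons_of_ne_nil hγ
    have hb' : BoundedJob N (w.tail, fun i => c i - 1, o) :=
      ⟨by have := hb.1; simp at this ⊢; omega, fun i => by have := hb.2 i; simp at this ⊢; omega⟩
    have hw' : w = w.head?.toList ++ w.tail := by cases w <;> simp
    have := ih (w := w.tail) (c := fun i => c i - 1) (n := fun i => n i + (c i - (c i - 1)))
      (by simp; omega) (fun i => by have := hc i; simp; omega) hb' (by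
        convert h using 2
        ext i
        simp
        omega)
    rw [show w ++ u = w.head?.toList ++ (w.tail ++ u) by rw [← List.append_assoc, ← hw']]
    refine SimMove.accepts (s := some _) (s' := some ⟨_, hb'⟩) (γ := [g])
      (z := fun i => decide (n i = 0))
      (δ := fun i => if c i = 0 then 0 else 1) (.tick hw' (fun i => ?_) fun i => ?_)
      (fun i => by simp) (fun i => ?_) this
    · by_cases h0 : c i = 0 <;> simp [h0]; omega
    · by_cases h0 : c i = 0 <;> simp [h0]
    · by_cases h0 : c i = 0 <;> simp [h0]; omega

theorem accepts_of_eq (m : ℕ) {n : Fin k → ℕ} (hn : ∀ i, n i = m) {γ : List (Option I)}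
    (hγ : γ ≠ []) : (G.simPDA N).Accepts
      ⟨some ⟨([], 0, none), by simp [BoundedJob]⟩, [], γ, n⟩ := by
  obtain ⟨g, rest, rfl⟩ := List.exists_cons_of_ne_nil hγ
  induction m generalizing n with
  | zero =>
    exact SimMove.accepts (s := some _) (s' := none) (x := none) .finish (fun i => by simp [hn i])
      (n' := n) (by simp) ⟨[], _, .nil _, rfl, rfl⟩
  | succ m ih =>
    refine SimMove.accepts (s := some _) (s' := some _) (x := none) (z := fun i => false)
      (γ := [g]) (δ := fun _ => -1) .decrease (fun i => by simp [hn i])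
      (n' := fun _ => m) (by simp [hn]) (ih fun _ => rfl)

theorem Generates.accepts (hN : ∀ p ∈ G.productions, ∀ w o, p.1.rhs = rightLinearWord w o →
      BoundedJob N (w, p.2, o)) {A : V} {α : List I} {n n' : Fin k → ℕ} {u : List T}
    (h : G.Generates A α n u n') (hn : ∀ i j, n' i = n' j) : (G.simPDA N).Accepts
      ⟨some ⟨([], 0, some A), by simp [BoundedJob]⟩, u, pushdown α, n⟩ := by
  -- One production is simulated by `produce`, which changes the pushdown and loads the job,
  -- followed by the ticks of that job.
  have key : ∀ {A : V} {α β : List I} {n : Fin k → ℕ}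
      {p : IndexedProduction T V I × (Fin k → ℕ)} {w u : List T} {o : Option V},
      p ∈ G.productions → p.1.Applies A α β → p.1.rhs = rightLinearWord w o →
      (G.simPDA N).Accepts
        ⟨some ⟨([], 0, o), by simp [BoundedJob]⟩, u, pushdown β, n + p.2⟩ →
      (G.simPDA N).Accepts
        ⟨some ⟨([], 0, some A), by simp [BoundedJob]⟩, w ++ u, pushdown α, n⟩ := by
    intro A α β n p w u o hp ha hr h
    have hb := hN p hp w o hr
    obtain ⟨g, γ, rest, he, h1, h2⟩ := exists_pushdownEffect ha
    have := accepts_tick N (pushdown_ne_nil β) hb.1 hb.2 hb h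
    rw [h2] at this
    rw [h1]
    exact SimMove.accepts (s := some _) (s' := some _) (x := none)
      (z := fun i => decide (n i = 0)) (.produce hp he hr) (fun i => by simp) (by simp) this
  induction h with
  | @halt A α β n p w hp ha hr =>
    have : (G.simPDA N).Accepts
        ⟨some ⟨([], 0, none), by simp [BoundedJob]⟩, [], pushdown β, n + p.2⟩ := by
      -- Without counters there is no common value to read off, and zero rounds of `decrease` will
      -- do.
      rcases isEmpty_or_nonempty (Fin k) with hk | ⟨⟨i⟩⟩
      · exact accepts_of_eq 0 (fun i => hk.elim i) (pushdown_ne_nil β)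
      · exact accepts_of_eq ((n + p.2) i) (fun j => hn j i) (pushdown_ne_nil β)
    simpa using key hp ha hr this
  | step hp ha hr _ ih => exact key hp ha hr (ih hn)

end Simulation

theorem exists_boundedJob (G : CounterIndexedGrammar T V I k) :
    ∃ N, ∀ p ∈ G.productions, ∀ w o, p.1.rhs = rightLinearWord w o →
      BoundedJob N (w, p.2, o) := by
  obtain ⟨N, hN⟩ := (G.finite_productions.image
    fun p => p.1.rhs.length + ∑ i, p.2 i).bddAbove
  refine ⟨N, fun p hp w o hr => ?_⟩
  have := hN ⟨p, hp, rfl⟩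
  simp only [hr, rightLinearWord, List.length_append, List.length_map] at this
  refine ⟨by simp; omega, fun i => ?_⟩
  have := Finset.single_le_sum (f := p.2) (fun i _ => Nat.zero_le _) (Finset.mem_univ i)
  simp
  omega

end CounterIndexedGrammar

theorem Language.IsRightLinearIndexedWithCounters.isNPCM {T : Type u} [Finite T]
    {L : Language T} (h : L.IsRightLinearIndexedWithCounters) : L.IsNPCM := by
  obtain ⟨k, V, I, hV, hI, G, hG, rfl⟩ := h
  obtain ⟨N, hN⟩ := G.exists_boundedJob
  have hF := CounterIndexedGrammar.finite_boundedJob (T := T) (V := V) (k := k) N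
  refine ⟨k, 1, _, _, inferInstance, inferInstance, G.simPDA N, ?_, ?_⟩
  · rintro w ts ⟨c, hc, -⟩ i
    exact CounterIndexedGrammar.counterReversalsFrom_le_one_of_computation hc i le_rfl
  · ext u
    rw [CounterPDA.mem_language_iff_accepts, CounterIndexedGrammar.mem_language_iff hG]
    constructor
    · rintro ⟨ts, c, hc, hi, hs⟩
      obtain ⟨u', n', rfl, h, hn⟩ :=
        CounterIndexedGrammar.simAccepts_of_computation hc hi hs [] rfl
      exact ⟨n', by simpa [CounterPDA.init] using h, hn⟩
    · rintro ⟨n, h, hn⟩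
      exact h.accepts hN hn

/-! ### Checking the zero tests of a single counter -/

/-- The sequence of zero tests and moves is possible for a counter with value `v`. -/
def ValidTrace : ℕ → List (Bool × SignType) → Prop
  | _, [] => True
  | v, (b, d) :: tr => (b = true ↔ v = 0) ∧ ∃ v' : ℕ, (v' : ℤ) = v + (d : ℤ) ∧ ValidTrace v' tr

/-- What is required of a value that was checked: nothing (no check), to be zero, or to be
nonnegative. -/
def Checked : Option Bool → ℤ → Prop
  | none, _ => True
  | some false, z => z = 0
  | some true, z => 0 ≤ z

/-- A state of the checker of one counter. The first component is `0` if the counter is zero, `1`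
if it is positive, and `-1` if it is claimed to be positive and has to be checked later, after
further decrements. The second one tells which checks have been made, and of which kind. -/
abbrev CheckState (C : ℕ) : Type := SignType × (Fin C → Option Bool)

/-- Record a move in the increasing counters of all checks that have not been made yet: in
`(j, true)` for an increment, and in `(j, false)` for a decrement. -/
def track {C : ℕ} (s : Fin C → Option Bool) (d : SignType) (x : Fin C × Bool) : ℕ :=
  if s x.1 = none ∧ d = (if x.2 then 1 else -1) then 1 else 0

/-- The steps of the checker of one counter. -/
inductive CheckStep {C : ℕ} :
    CheckState C → Bool × SignType → (Fin C × Bool → ℕ) → CheckState C → Prop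
  | zero (s : Fin C → Option Bool) : CheckStep (0, s) (true, 0) (track s 0) (0, s)
  | start (s : Fin C → Option Bool) : CheckStep (0, s) (true, 1) (track s 1) (1, s)
  | stay {m : SignType} (s : Fin C → Option Bool) (hm : m ≠ 0) :
      CheckStep (m, s) (false, 0) (track s 0) (m, s)
  | inc (s : Fin C → Option Bool) : CheckStep (1, s) (false, 1) (track s 1) (1, s)
  | dec {m : SignType} (s : Fin C → Option Bool) (hm : m ≠ 0) :
      CheckStep (m, s) (false, -1) (track s (-1)) (-1, s)
  | reach {m : SignType} (s : Fin C → Option Bool) (hm : m ≠ 0) (j : Fin C) (hj : s j = none) :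
      CheckStep (m, s) (false, -1) (track s (-1)) (0, Function.update s j (some false))
  -- The extra unit on the decrement side turns the check "nonnegative" into "positive after this
  -- decrement".
  | turn {m : SignType} (s : Fin C → Option Bool) (hm : m ≠ 0) (j : Fin C) (hj : s j = none) :
      CheckStep (m, s) (false, -1) (track s (-1) + Pi.single (j, false) 1)
        (1, Function.update s j (some true))

/-- The runs of the checker of one counter, with the sum of the counter increments. -/
inductive CheckRun {C : ℕ} :
    CheckState C → List (Bool × SignType) → (Fin C × Bool → ℕ) → CheckState C → Prop
  | nil (s : CheckState C) : CheckRun s [] 0 s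
  | cons {s s' s'' : CheckState C} {x : Bool × SignType} {tr : List (Bool × SignType)}
      {c Δ : Fin C × Bool → ℕ} (h : CheckStep s x c s') (h' : CheckRun s' tr Δ s'') :
      CheckRun s (x :: tr) (c + Δ) s''

theorem track_eq_zero {C : ℕ} {s : Fin C → Option Bool} {j : Fin C} {r : Bool} (hj : s j = some r)
    (d : SignType) (b : Bool) : track s d (j, b) = 0 := by
  simp [track, hj]

theorem track_sub_track {C : ℕ} {s : Fin C → Option Bool} {j : Fin C} (hj : s j = none)
    (d : SignType) : (track s d (j, true) : ℤ) - track s d (j, false) = d := by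
  cases d <;> simp [track, hj]

theorem CheckStep.le_two {C : ℕ} {s s' : CheckState C} {x : Bool × SignType}
    {c : Fin C × Bool → ℕ} (h : CheckStep s x c s') (y : Fin C × Bool) : c y ≤ 2 := by
  have ht : ∀ s : Fin C → Option Bool, ∀ d, track s d y ≤ 1 := fun s d => by
    unfold track; split_ifs <;> simp
  cases h with
  | turn s hm j hj =>
    have h1 := ht s (-1)
    have h2 : (Pi.single (j, false) 1 : Fin C × Bool → ℕ) y ≤ 1 := by
      rw [Pi.single_apply]; split_ifs <;> simp
    simp only [Pi.add_apply]
    omega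
  | _ => exact (ht _ _).trans one_le_two

/-- A check that has been made is frozen, so the final values of its two counters speak of the
moment of the check. -/
theorem CheckStep.of_some {C : ℕ} {s s' : CheckState C} {x : Bool × SignType}
    {c : Fin C × Bool → ℕ} (h : CheckStep s x c s') {j : Fin C} {r : Bool}
    (hj : s.2 j = some r) : s'.2 j = some r ∧ ∀ b, c (j, b) = 0 := by
  cases h with
  | reach s hm j' hj' =>
    have hne : j ≠ j' := by rintro rfl; simp_all
    exact ⟨by simpa [hne] using hj, track_eq_zero hj _⟩
  | turn s hm j' hj' =>
    have hne : j ≠ j' := by rintro rfl; simp_all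
    exact ⟨by simpa [hne] using hj, fun b => by simp [track_eq_zero hj, hne]⟩
  | _ => exact ⟨hj, track_eq_zero hj _⟩

theorem CheckRun.of_some {C : ℕ} {s s' : CheckState C} {tr : List (Bool × SignType)}
    {Δ : Fin C × Bool → ℕ} (h : CheckRun s tr Δ s') {j : Fin C} {r : Bool}
    (hj : s.2 j = some r) : s'.2 j = some r ∧ ∀ b, Δ (j, b) = 0 := by
  induction h with
  | nil s => exact ⟨hj, fun b => rfl⟩
  | cons h _ ih =>
    obtain ⟨h1, h2⟩ := h.of_some hj
    obtain ⟨h3, h4⟩ := ih h1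
    exact ⟨h3, fun b => by simp [h2, h4]⟩

/-- Soundness of the checker. The value `v` is an integer, because in mode `-1` nothing is known
about it yet. That mode has to be left before the end, through `reach` or `turn`, and until then the
counter never increases; so the check made there shows that `v` was positive all along. -/
theorem CheckRun.validTrace {C : ℕ} {s s' : CheckState C} {tr : List (Bool × SignType)}
    {Δ : Fin C × Bool → ℕ} (h : CheckRun s tr Δ s') (hs' : s'.1 ≠ -1) (v : ℤ)
    (hv : ∀ j, s.2 j = none → Checked (s'.2 j) (v + (Δ (j, true) - Δ (j, false))))
    (h0 : s.1 = 0 → v = 0) (h1 : s.1 = 1 → 1 ≤ v) :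
    ∃ m : ℕ, (m : ℤ) = v ∧ (s.1 = -1 → 1 ≤ m) ∧ ValidTrace m tr := by
  induction h generalizing v with
  | nil s =>
    refine ⟨v.toNat, Int.toNat_of_nonneg ?_, fun h => absurd h hs', trivial⟩
    obtain ⟨m, s⟩ := s
    cases m
    · exact (h0 rfl).ge
    · exact absurd rfl hs'
    · exact (Int.zero_le_ofNat 1).trans (h1 rfl)
  | @cons s s₁ s₂ x tr c Δ h h' ih =>
    -- While check `j` is open, `v` plus the recorded future moves is invariant: the move leaves the
    -- record and enters the value.
    have next : ∀ j, s.2 j = none → (c = track s.2 x.2 ∨ c (j, true) =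
        track s.2 x.2 (j, true) ∧ c (j, false) = track s.2 x.2 (j, false)) →
        Checked (s₂.2 j) (v + (x.2 : ℤ) + (Δ (j, true) - Δ (j, false))) := by
      intro j hj hc
      have hc' : (c (j, true) : ℤ) - c (j, false) = x.2 := by
        rw [← track_sub_track hj x.2]
        rcases hc with rfl | ⟨e1, e2⟩
        · rfl
        · rw [e1, e2]
      convert hv j hj using 1
      push_cast [Pi.add_apply]
      linarith
    cases h with
    | zero s =>
      obtain rfl := h0 rfl
      obtain ⟨m, hm, -, hm'⟩ := ih hs' _ (fun j hj => next j hj (.inl rfl)) (by simp)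
        (fun h => by simp at h)
      exact ⟨0, rfl, by simp, by simp, m, by simpa using hm, hm'⟩
    | start s =>
      obtain rfl := h0 rfl
      obtain ⟨m, hm, -, hm'⟩ := ih hs' _ (fun j hj => next j hj (.inl rfl))
        (fun h => by simp at h) (by simp)
      exact ⟨0, rfl, by simp, by simp, m, by simpa using hm, hm'⟩
    | @stay m s hm =>
      obtain ⟨m', h2, h3, h4⟩ := ih hs' _ (fun j hj => next j hj (.inl rfl))
        (fun h => absurd h hm) (fun h => by simpa using h1 h)
      simp only [SignType.coe_zero, add_zero] at h2
      have h5 : 1 ≤ m' := by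
        cases m
        · exact absurd rfl hm
        · exact h3 rfl
        · have := h1 rfl; omega
      exact ⟨m', h2, fun _ => h5, by simp; omega, m', by simp, h4⟩
    | inc s =>
      have h5 := h1 rfl
      obtain ⟨m', h2, -, h4⟩ := ih hs' _ (fun j hj => next j hj (.inl rfl))
        (fun h => by simp at h) (fun h => by simp; omega)
      exact ⟨v.toNat, by omega, fun h => by simp at h, by simp; omega, m',
        by rw [h2]; simp; omega, h4⟩
    | @dec m s hm =>
      obtain ⟨m', h2, h3, h4⟩ := ih hs' _ (fun j hj => next j hj (.inl rfl))
        (fun h => by simp at h) (fun h => absurd (show (-1 : SignType) = 1 from h) (by decide))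
      have h5 := h3 rfl
      simp at h2
      exact ⟨v.toNat, by omega, fun _ => by omega, by simp; omega, m', by rw [h2]; simp; omega, h4⟩
    | @reach m s hm j hj =>
      -- After the check nothing is recorded for `j`, so `hv j` reduces to `v - 1 = 0`; for `turn`
      -- it reduces to `v - 2 ≥ 0`.
      obtain ⟨e1, e2⟩ := h'.of_some (j := j) (r := false) (by simp)
      have h6 := hv j hj
      have h7 := track_sub_track hj (-1)
      simp [e1, e2, Checked] at h6 h7
      obtain ⟨m', h2, -, h4⟩ := ih hs' (v + ((-1 : SignType) : ℤ)) (fun j' hj' => by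
        have hne : j' ≠ j := by rintro rfl; simp at hj'
        exact next j' (by simpa [hne] using hj') (.inl rfl)) (fun _ => by simp; omega)
        (fun h => by simp at h)
      exact ⟨v.toNat, by omega, fun _ => by omega, by simp; omega, m', by rw [h2]; simp; omega, h4⟩
    | @turn m s hm j hj =>
      obtain ⟨e1, e2⟩ := h'.of_some (j := j) (r := true) (by simp)
      have h6 := hv j hj
      have h7 := track_sub_track hj (-1)
      simp [e1, e2, Checked] at h6 h7
      obtain ⟨m', h2, -, h4⟩ := ih hs' (v + ((-1 : SignType) : ℤ)) (fun j' hj' => by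
        have hne : j' ≠ j := by rintro rfl; simp at hj'
        exact next j' (by simpa [hne] using hj')
          (.inr ⟨by simp, by simp [hne]⟩))
        (fun h => by simp at h) (fun _ => by simp; omega)
      exact ⟨v.toNat, by omega, fun _ => by omega, by simp; omega, m', by rw [h2]; simp; omega, h4⟩

/-- The checker has a run on the trace that confirms the trace for the counter value `v`. -/
def Confirms {C : ℕ} (s : CheckState C) (tr : List (Bool × SignType)) (v : ℕ) : Prop :=
  ∃ Δ s', CheckRun s tr Δ s' ∧ s'.1 ≠ -1 ∧
    ∀ j, s.2 j = none → Checked (s'.2 j) (v + (Δ (j, true) - Δ (j, false)))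

theorem Confirms.nil {C : ℕ} {s : CheckState C} (hs : s.1 ≠ -1) (v : ℕ) : Confirms s [] v :=
  ⟨0, s, .nil s, hs, fun j hj => by rw [hj]; trivial⟩

theorem Confirms.cons {C : ℕ} {m m' : SignType} {s : Fin C → Option Bool} {x : Bool × SignType}
    {tr : List (Bool × SignType)} {v v' : ℕ} (h : CheckStep (m, s) x (track s x.2) (m', s))
    (hv : (v' : ℤ) = v + (x.2 : ℤ)) (h' : Confirms (m', s) tr v') :
    Confirms (m, s) (x :: tr) v := by
  obtain ⟨Δ, s', hr, hs', hc⟩ := h'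
  refine ⟨_, s', .cons h hr, hs', fun j hj => ?_⟩
  convert hc j hj using 1
  have := track_sub_track hj x.2
  push_cast [Pi.add_apply]
  linarith

/-- The number of checks that have not been made. -/
def numFree {C : ℕ} (s : Fin C → Option Bool) : ℕ := (Finset.univ.filter fun j => s j = none).card

theorem numFree_update {C : ℕ} {s : Fin C → Option Bool} {j : Fin C} (hj : s j = none) (b : Bool) :
    numFree (Function.update s j (some b)) = numFree s - 1 := by
  unfold numFree
  rw [← Finset.card_erase_of_mem (a := j) (by simpa using hj)]
  congr 1
  ext i
  by_cases h : i = j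
  · subst h; simp
  · simp [h]

theorem exists_eq_none_of_numFree {C : ℕ} {s : Fin C → Option Bool} (h : 0 < numFree s) :
    ∃ j, s j = none := by
  obtain ⟨j, hj⟩ := Finset.card_pos.1 h
  exact ⟨j, by simpa using hj⟩

theorem Confirms.reach {C : ℕ} {m : SignType} {s : Fin C → Option Bool} (hm : m ≠ 0) {j : Fin C}
    (hj : s j = none) {tr : List (Bool × SignType)}
    (h : Confirms (0, Function.update s j (some false)) tr 0) :
    Confirms (m, s) ((false, -1) :: tr) 1 := by
  obtain ⟨Δ, s', hr, hs', hc⟩ := h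
  refine ⟨_, s', .cons (.reach s hm j hj) hr, hs', fun i hi => ?_⟩
  have h7 := track_sub_track hi (-1)
  by_cases hne : i = j
  · subst hne
    obtain ⟨e1, e2⟩ := hr.of_some (j := i) (r := false) (by simp)
    simp [e1, e2, Checked] at h7 ⊢
    omega
  · convert hc i (by simpa [hne] using hi) using 1
    simp at h7 ⊢
    linarith

theorem Confirms.turn {C : ℕ} {m : SignType} {s : Fin C → Option Bool} (hm : m ≠ 0) {j : Fin C}
    (hj : s j = none) {tr : List (Bool × SignType)} {v : ℕ} (hv : 0 < v)
    (h : Confirms (1, Function.update s j (some true)) tr v) :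
    Confirms (m, s) ((false, -1) :: tr) (v + 1) := by
  obtain ⟨Δ, s', hr, hs', hc⟩ := h
  refine ⟨_, s', .cons (.turn s hm j hj) hr, hs', fun i hi => ?_⟩
  have h7 := track_sub_track hi (-1)
  by_cases hne : i = j
  · subst hne
    obtain ⟨e1, e2⟩ := hr.of_some (j := i) (r := true) (by simp)
    simp [e1, e2, Checked] at h7 ⊢
    omega
  · convert hc i (by simpa [hne] using hi) using 1
    simp [hne] at h7 ⊢
    linarith

/-- Completeness of the checker: each up-to-down reversal pays for one check. At a positive value
after a decrement there are two cases. Either no decrement precedes the next increment or the end,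
and the checker can be in mode `1` with this stretch already checked; or the stretch goes on, and
mode `-1` needs one further free check, which the reversal at its beginning has paid for. -/
theorem confirms_of_validTrace {C : ℕ} (tr : List (Bool × SignType)) (v : ℕ) (d : SignType)
    (h : ValidTrace v tr) :
    (v = 0 → ∀ s : Fin C → Option Bool, counterReversalsFrom d (tr.map Prod.snd) ≤ numFree s →
      Confirms (0, s) tr v) ∧
    (0 < v → d = 1 → ∀ s : Fin C → Option Bool,
      counterReversalsFrom d (tr.map Prod.snd) ≤ numFree s → Confirms (1, s) tr v) ∧
    (0 < v → d = -1 →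
      (∀ s : Fin C → Option Bool, counterReversalsFrom d (tr.map Prod.snd) ≤ numFree s →
        Confirms (1, s) tr v) ∨
      ∀ s : Fin C → Option Bool, counterReversalsFrom d (tr.map Prod.snd) + 1 ≤ numFree s →
        Confirms (-1, s) tr v) := by
  induction tr generalizing v d with
  | nil =>
    exact ⟨fun _ s _ => .nil (by simp) v, fun _ _ s _ => .nil (by simp) v,
      fun _ _ => .inl fun s _ => .nil (by simp) v⟩
  | cons x tr ih =>
    obtain ⟨b, e⟩ := x
    obtain ⟨hb, v', hv', ht⟩ := h
    -- A decrement uses `reach` if it arrives at zero, `turn` if it is the last of its stretch, and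
    -- `dec` otherwise. The spare `+ 1` is the check of the current stretch.
    have decr : ∀ {m : SignType}, m ≠ 0 → 0 < v → e = -1 → ∀ s : Fin C → Option Bool,
        counterReversalsFrom (-1) (tr.map Prod.snd) + 1 ≤ numFree s →
        Confirms (m, s) ((b, e) :: tr) v := by
      rintro m hm hv rfl s hs
      obtain rfl : b = false := by simpa [hv.ne'] using hb
      obtain rfl : v = v' + 1 := by simp at hv'; omega
      obtain ⟨j, hj⟩ := exists_eq_none_of_numFree (s := s) (by omega)
      obtain ⟨i1, -, i3⟩ := ih v' (-1) ht
      rcases Nat.eq_zero_or_pos v' with rfl | hv0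
      · exact .reach hm hj (i1 rfl _ (by rw [numFree_update hj]; omega))
      · rcases i3 hv0 rfl with i3 | i3
        · exact .turn hm hj hv0 (i3 _ (by rw [numFree_update hj]; omega))
        · exact .cons (.dec s hm) (by simp) (i3 s hs)
    refine ⟨?_, ?_, ?_⟩
    · rintro rfl s hs
      obtain rfl : b = true := by simpa using hb
      cases e
      · obtain rfl : v' = 0 := by simpa using hv'
        exact .cons (.zero s) (by simp) ((ih 0 d ht).1 rfl s (by
          simpa [counterReversalsFrom] using hs))
      · simp at hv'
      · obtain rfl : v' = 1 := by simpa using hv'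
        -- A reversal from down to up costs no check, so the bound has slack here.
        refine .cons (.start s) (by simp) ((ih 1 1 ht).2.1 one_pos rfl s (le_trans ?_ hs))
        simp [counterReversalsFrom]
        split_ifs <;> simp
    · rintro hv rfl s hs
      obtain rfl : b = false := by simpa [hv.ne'] using hb
      cases e
      · obtain rfl : v' = v := by simpa using hv'
        exact .cons (.stay s one_ne_zero) (by simp) ((ih v' 1 ht).2.1 hv rfl s (by
          simpa [counterReversalsFrom] using hs))
      · exact decr one_ne_zero hv rfl s (by simpa [counterReversalsFrom] using hs)
      · exact .cons (.inc s) hv' ((ih v' 1 ht).2.1 (by simp at hv'; omega) rfl s (by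
          simpa [counterReversalsFrom] using hs))
    · rintro hv rfl
      obtain rfl : b = false := by simpa [hv.ne'] using hb
      cases e
      · obtain rfl : v' = v := by simpa using hv'
        rcases (ih v' (-1) ht).2.2 hv rfl with h | h
        · exact .inl fun s hs => .cons (.stay s one_ne_zero) (by simp) (h s (by
            simpa [counterReversalsFrom] using hs))
        · exact .inr fun s hs => .cons (.stay s (by decide)) (by simp) (h s (by
            simpa [counterReversalsFrom] using hs))
      · exact .inr fun s hs => decr (by decide) hv rfl s (by simpa [counterReversalsFrom] using hs)
      · refine .inl fun s hs => .cons (.inc s) hv'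
          ((ih v' 1 ht).2.1 (by simp at hv'; omega) rfl s (le_trans ?_ hs))
        simp [counterReversalsFrom]

/-! ### From automata to grammars -/

namespace CounterPDA

variable {T Q Γ : Type u} {k : ℕ}

/-- Accepting runs of the pushdown automaton without regard to the counters. -/
inductive PushdownRun (M : CounterPDA T Q Γ k) :
    Q → List T → List Γ → List (NPCMTransition T Q Γ k) → Prop
  | nil {q : Q} (hq : q ∈ M.accept) (α : List Γ) : PushdownRun M q [] α []
  | cons {t : NPCMTransition T Q Γ k} {u : List T} {α : List Γ}
      {ts : List (NPCMTransition T Q Γ k)} (ht : t ∈ M.transitions)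
      (h : PushdownRun M t.target u (t.push ++ α) ts) :
      PushdownRun M t.source (t.input.toList ++ u) (t.top :: α) (t :: ts)

/-- The zero tests and moves of the counter `i`. -/
def trace (i : Fin k) (ts : List (NPCMTransition T Q Γ k)) : List (Bool × SignType) :=
  ts.map fun t => (t.isZero i, t.delta i)

theorem Computation.pushdownRun {M : CounterPDA T Q Γ k} {c c' : NPCMConfig T Q Γ k}
    {ts : List (NPCMTransition T Q Γ k)} (h : M.Computation c ts c') (hi : c'.input = [])
    (hs : c'.state ∈ M.accept) : M.PushdownRun c.state c.input c.stack ts ∧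
      ∀ i, ValidTrace (c.counters i) (trace i ts) := by
  induction h with
  | nil c => exact ⟨by rw [hi]; exact .nil hs _, fun i => trivial⟩
  | @cons c c₁ c₂ t ts ht hf _ ih =>
    obtain ⟨ih1, ih2⟩ := ih hi hs
    obtain ⟨h1, h2, h3, ⟨rest, h4, h5⟩, h6, h7⟩ := hf
    rw [h2, h5] at ih1
    rw [h1, h3, h4]
    exact ⟨.cons ht ih1, fun i => ⟨h6 i, c₁.counters i, h7 i, ih2 i⟩⟩

/-- The transitions spell out their zero tests and moves, so the counters can be verified one by
one, independently of the pushdown. -/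
theorem PushdownRun.accepts {M : CounterPDA T Q Γ k} {q : Q} {u : List T} {α : List Γ}
    {ts : List (NPCMTransition T Q Γ k)} (h : M.PushdownRun q u α ts) {n : Fin k → ℕ}
    (hn : ∀ i, ValidTrace (n i) (trace i ts)) : M.Accepts ⟨q, u, α, n⟩ := by
  induction h generalizing n with
  | nil hq α => exact ⟨[], _, .nil _, rfl, hq⟩
  | @cons t u α ts ht _ ih =>
    choose hz n' hn' hv using hn
    exact (ih hv).cons ht ⟨rfl, rfl, rfl, ⟨α, rfl, rfl⟩, hz, hn'⟩

end CounterPDA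

theorem rightLinearWord_inj {T V : Type u} {w w' : List T} {o o' : Option V}
    (h : rightLinearWord w o = rightLinearWord w' o') : w = w' ∧ o = o' := by
  induction w generalizing w' with
  | nil => cases w' <;> cases o <;> cases o' <;> simp_all [rightLinearWord]
  | cons a w ih =>
    cases w' with
    | nil => cases o' <;> simp [rightLinearWord] at h
    | cons b w' =>
      simp only [rightLinearWord, List.map_cons, List.cons_append, List.cons.injEq,
        Symbol.terminal.injEq] at h
      obtain ⟨rfl, rfl⟩ := ih h.2
      exact ⟨by rw [h.1], rfl⟩

theorem finite_setOf_rhs_length_le {T V I : Type u} [Finite T] [Finite V] [Finite I] (k N : ℕ) :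
    {p : IndexedProduction T V I × (Fin k → ℕ) |
      p.1.rhs.length ≤ N ∧ ∀ i, p.2 i ≤ N}.Finite := by
  have hS : Finite (Symbol T V) :=
    Finite.of_injective (β := T ⊕ V) (fun s => s.casesOn Sum.inl Sum.inr) (by
      rintro (a | a) (b | b) h <;> simp_all)
  have hF : Finite {l : List (Symbol T V) // l.length ≤ N} := List.finite_length_le _ N
  have h₁ : {p : IndexedProduction T V I | p.rhs.length ≤ N}.Finite := by
    refine (Set.finite_range fun x : (V × {l : List (Symbol T V) // l.length ≤ N}) ⊕ (V × V × I) ⊕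
      (V × I × {l : List (Symbol T V) // l.length ≤ N}) => (match x with
        | .inl x => .rewrite x.1 x.2.1
        | .inr (.inl x) => .push x.1 x.2.1 x.2.2
        | .inr (.inr x) => .pop x.1 x.2.1 x.2.2.1 : IndexedProduction T V I)).subset ?_
    rintro (⟨A, ν⟩ | ⟨A, B, f⟩ | ⟨A, f, ν⟩) h
    · exact ⟨.inl (A, ⟨ν, h⟩), rfl⟩
    · exact ⟨.inr (.inl (A, B, f)), rfl⟩
    · exact ⟨.inr (.inr (A, f, ⟨ν, h⟩)), rfl⟩
  have h₂ : {c : Fin k → ℕ | ∀ i, c i ≤ N}.Finite :=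
    (Set.finite_Iic (fun _ : Fin k => N)).subset fun c hc i => hc i
  exact (h₁.prod h₂).subset fun p hp => hp

namespace CounterPDA

variable {T Q Γ : Type u} {k C N : ℕ}

/-- Nonterminals of the grammar that simulates an automaton: either a state, the states of the
checkers of the counters and the symbols that have yet to be pushed, or only the checks that were
made, at the end of a derivation. -/
abbrev CheckNonterminal (Q Γ : Type u) (k C N : ℕ) : Type u :=
  (Q × (Fin k → CheckState C) × {w : List Γ // w.length ≤ N}) ⊕ (Fin k → Fin C → Option Bool)

instance [Finite Q] [Finite Γ] : Finite (CheckNonterminal Q Γ k C N) :=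
  have : Finite {w : List Γ // w.length ≤ N} := List.finite_length_le Γ N
  inferInstance

/-- Vectors that may be added to the counters at the end: the result of no check is changed to the
better. -/
def IsPadding (st : Fin k → Fin C → Option Bool) (c : Fin k × Fin C × Bool → ℕ) : Prop :=
  ∀ i j, Checked (st i j) (c (i, j, false) - c (i, j, true))

/-- The productions of the grammar that simulates an automaton. -/
inductive CheckProduction (M : CounterPDA T Q Γ k) :
    IndexedProduction T (CheckNonterminal Q Γ k C N) Γ → (Fin k × Fin C × Bool → ℕ) → Prop
  | push (q : Q) (σ : Fin k → CheckState C) (f : Γ) (w : List Γ) (h : (f :: w).length ≤ N)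
      (h' : w.length ≤ N) :
      CheckProduction M (.push (.inl (q, σ, ⟨f :: w, h⟩)) (.inl (q, σ, ⟨w, h'⟩)) f) 0
  | move {t : NPCMTransition T Q Γ k} (ht : t ∈ M.transitions) {σ σ' : Fin k → CheckState C}
      {c : Fin k × Fin C × Bool → ℕ}
      (hc : ∀ i, CheckStep (σ i) (t.isZero i, t.delta i) (fun x => c (i, x)) (σ' i))
      (h : t.push.reverse.length ≤ N) : CheckProduction M
        (.pop (.inl (t.source, σ, ⟨[], Nat.zero_le N⟩)) t.top
          (rightLinearWord t.input.toList (some (.inl (t.target, σ', ⟨t.push.reverse, h⟩))))) c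
  | finish {q : Q} (hq : q ∈ M.accept) {σ : Fin k → CheckState C} (hσ : ∀ i, (σ i).1 ≠ -1) :
      CheckProduction M (.rewrite (.inl (q, σ, ⟨[], Nat.zero_le N⟩))
        (rightLinearWord [] (some (.inr fun i => (σ i).2)))) 0
  | pad {st : Fin k → Fin C → Option Bool} {c : Fin k × Fin C × Bool → ℕ} (hc : ∀ x, c x ≤ 1)
      (hst : IsPadding st c) :
      CheckProduction M (.rewrite (.inr st) (rightLinearWord [] (some (.inr st)))) c
  | halt (st : Fin k → Fin C → Option Bool) :
      CheckProduction M (.rewrite (.inr st) (rightLinearWord [] none)) 0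

/-- Makes the set of productions finite. An increment of 2 occurs only in `turn`, which charges its
decrement twice. -/
theorem CheckProduction.bound {M : CounterPDA T Q Γ k}
    {p : IndexedProduction T (CheckNonterminal Q Γ k C N) Γ} {c : Fin k × Fin C × Bool → ℕ}
    (h : M.CheckProduction p c) : p.rhs.length ≤ 2 ∧ ∀ x, c x ≤ 2 := by
  cases h with
  | push => exact ⟨by simp [IndexedProduction.rhs], fun x => Nat.zero_le _⟩
  | @move t ht σ σ' c hc h =>
    refine ⟨?_, fun x => (hc x.1).le_two x.2⟩
    cases t.input <;> simp [IndexedProduction.rhs, rightLinearWord]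
  | finish => exact ⟨by simp [IndexedProduction.rhs, rightLinearWord], fun x => Nat.zero_le _⟩
  | pad hc => exact ⟨by simp [IndexedProduction.rhs, rightLinearWord],
      fun x => (hc x).trans one_le_two⟩
  | halt => exact ⟨by simp [IndexedProduction.rhs, rightLinearWord], fun x => Nat.zero_le _⟩

theorem CheckProduction.exists_rhs {M : CounterPDA T Q Γ k}
    {p : IndexedProduction T (CheckNonterminal Q Γ k C N) Γ} {c : Fin k × Fin C × Bool → ℕ}
    (h : M.CheckProduction p c) : ∃ w o, p.rhs = rightLinearWord w o := by
  cases h with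
  | push q σ f w h h' => exact ⟨[], some _, rfl⟩
  | _ => exact ⟨_, _, rfl⟩

/-- What the derivations from a nonterminal of the simulating grammar say about the automaton. -/
def CheckMeaning (M : CounterPDA T Q Γ k) : CheckNonterminal Q Γ k C N → List Γ →
    (Fin k × Fin C × Bool → ℕ) → List T → (Fin k × Fin C × Bool → ℕ) → Prop
  | .inl (q, σ, w), α, n, u, n' => ∃ (ts : List (NPCMTransition T Q Γ k))
      (σ' : Fin k → CheckState C) (Δ : Fin k → Fin C × Bool → ℕ)
      (D : Fin k × Fin C × Bool → ℕ), M.PushdownRun q u (w.1.reverse ++ α) ts ∧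
      (∀ i, CheckRun (σ i) (trace i ts) (Δ i) (σ' i) ∧ (σ' i).1 ≠ -1) ∧
      IsPadding (fun i => (σ' i).2) D ∧ ∀ i x, n' (i, x) = n (i, x) + Δ i x + D (i, x)
  | .inr st, _, n, u, n' => u = [] ∧ ∃ D, IsPadding st D ∧ n' = n + D

theorem IsPadding.zero (st : Fin k → Fin C → Option Bool) : IsPadding st 0 := by
  intro i j
  rcases st i j with _ | _ | _ <;> simp [Checked]

theorem IsPadding.add {st : Fin k → Fin C → Option Bool} {c c' : Fin k × Fin C × Bool → ℕ}
    (h : IsPadding st c) (h' : IsPadding st c') : IsPadding st (c + c') := by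
  intro i j
  have h1 := h i j
  have h2 := h' i j
  generalize st i j = b at h1 h2 ⊢
  rcases b with _ | _ | _ <;> simp [Checked] at h1 h2 ⊢ <;> omega

theorem CheckProduction.meaning_halt {M : CounterPDA T Q Γ k}
    {p : IndexedProduction T (CheckNonterminal Q Γ k C N) Γ} {c : Fin k × Fin C × Bool → ℕ}
    (h : M.CheckProduction p c) {A : CheckNonterminal Q Γ k C N} {α β : List Γ}
    (ha : p.Applies A α β) {w : List T} (hr : p.rhs = rightLinearWord w none)
    (n : Fin k × Fin C × Bool → ℕ) : M.CheckMeaning A α n w (n + c) := by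
  cases h with
  | halt st =>
    obtain ⟨rfl, -⟩ := rightLinearWord_inj hr
    cases ha
    exact ⟨rfl, 0, .zero st, rfl⟩
  | push q σ f w h h' => exact absurd (rightLinearWord_inj (w := []) (o := some _) hr).2 (by simp)
  | _ => exact absurd (rightLinearWord_inj hr).2 (by simp)

theorem CheckProduction.meaning_step {M : CounterPDA T Q Γ k}
    {p : IndexedProduction T (CheckNonterminal Q Γ k C N) Γ} {c : Fin k × Fin C × Bool → ℕ}
    (h : M.CheckProduction p c) {A B : CheckNonterminal Q Γ k C N} {α β : List Γ}
    (ha : p.Applies A α β) {w u : List T} (hr : p.rhs = rightLinearWord w (some B))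
    {n n' : Fin k × Fin C × Bool → ℕ} (hB : M.CheckMeaning B β (n + c) u n') :
    M.CheckMeaning A α n (w ++ u) n' := by
  cases h with
  | push q σ f w h h' =>
    obtain ⟨rfl, e⟩ := rightLinearWord_inj (w := []) (o := some _) hr
    obtain rfl := Option.some.inj e
    cases ha
    obtain ⟨ts, σ', Δ, D, h1, h2, h3, h4⟩ := hB
    exact ⟨ts, σ', Δ, D, by simpa using h1, h2, h3, by simpa using h4⟩
  | @move t ht σ σ₁ c hc h =>
    obtain ⟨rfl, e⟩ := rightLinearWord_inj hr
    obtain rfl := Option.some.inj e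
    cases ha
    obtain ⟨ts, σ', Δ, D, h1, h2, h3, h4⟩ := hB
    refine ⟨t :: ts, σ', fun i => (fun x => c (i, x)) + Δ i, D, .cons ht (by simpa using h1),
      fun i => ⟨.cons (hc i) (h2 i).1, (h2 i).2⟩, h3, fun i x => ?_⟩
    rw [h4]
    simp only [Pi.add_apply]
    ring
  | @finish q hq σ hσ =>
    obtain ⟨rfl, e⟩ := rightLinearWord_inj hr
    obtain rfl := Option.some.inj e
    cases ha
    obtain ⟨rfl, D, h1, rfl⟩ := hB
    exact ⟨[], σ, fun _ => 0, D, .nil hq _, fun i => ⟨.nil _, hσ i⟩, h1, fun i x => by simp⟩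
  | @pad st c hc hst =>
    obtain ⟨rfl, e⟩ := rightLinearWord_inj hr
    obtain rfl := Option.some.inj e
    cases ha
    obtain ⟨rfl, D, h1, rfl⟩ := hB
    exact ⟨rfl, c + D, hst.add h1, by rw [add_assoc]⟩
  | halt st => exact absurd (rightLinearWord_inj hr).2 (by simp)

/-- The number of counters of the simulating grammar. -/
abbrev numCheckCounters (k C : ℕ) : ℕ := Fintype.card (Fin k × Fin C × Bool)

/-- The numbering of the counters of the simulating grammar. -/
noncomputable def checkIndex (k C : ℕ) : Fin k × Fin C × Bool ≃ Fin (numCheckCounters k C) :=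
  Fintype.equivFin _

/-- The right-linear indexed grammar with counters that simulates an automaton. -/
noncomputable def checkGrammar [Finite T] [Finite Q] [Finite Γ] (M : CounterPDA T Q Γ k)
    (C N : ℕ) (hN : 1 ≤ N) : CounterIndexedGrammar T (CheckNonterminal Q Γ k C N) Γ
      (numCheckCounters k C) where
  start := .inl (M.start, fun _ => (0, fun _ => none), ⟨[M.bottom], hN⟩)
  productions := {p | M.CheckProduction p.1 (p.2 ∘ checkIndex k C)}
  finite_productions := (finite_setOf_rhs_length_le _ 2).subset fun p hp =>
    ⟨hp.bound.1, fun i => by simpa using hp.bound.2 ((checkIndex k C).symm i)⟩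

section Simulation

variable [Finite T] [Finite Q] [Finite Γ] {M : CounterPDA T Q Γ k} {hN : 1 ≤ N}

theorem checkGrammar_isRightLinear : (M.checkGrammar C N hN).underlying.IsRightLinear :=
  (CounterIndexedGrammar.underlying_isRightLinear_iff _).2 fun _ hp =>
    CheckProduction.exists_rhs hp

theorem checkMeaning_of_generates {A : CheckNonterminal Q Γ k C N} {α : List Γ}
    {n n' : Fin (numCheckCounters k C) → ℕ} {u : List T}
    (h : (M.checkGrammar C N hN).Generates A α n u n') :
    M.CheckMeaning A α (n ∘ checkIndex k C) u (n' ∘ checkIndex k C) := by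
  induction h with
  | halt hp ha hr => exact CheckProduction.meaning_halt hp ha hr _
  | step hp ha hr _ ih => exact CheckProduction.meaning_step hp ha hr ih

/-- Equality of the final counters says that the padding makes up the difference between recorded
increments and decrements, so the conditions of `IsPadding` become the outcomes of the checks.
Reversal-boundedness plays no role in this direction. -/
theorem mem_language_of_mem_checkGrammar {u : List T}
    (hu : u ∈ (M.checkGrammar C N hN).language) : u ∈ M.language := by
  obtain ⟨n, h, hn⟩ := (CounterIndexedGrammar.mem_language_iff checkGrammar_isRightLinear).1 hu
  obtain ⟨ts, σ', Δ, D, h1, h2, h3, h4⟩ := checkMeaning_of_generates h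
  refine mem_language_iff_accepts.2 (h1.accepts (n := 0) fun i => ?_)
  have hc : ∀ j, Checked ((σ' i).2 j) (0 + (Δ i (j, true) - Δ i (j, false))) := fun j => by
    have e1 := h4 i (j, true)
    have e2 := h4 i (j, false)
    have e3 := h3 i j
    have e4 := hn (checkIndex k C (i, j, true)) (checkIndex k C (i, j, false))
    simp only [Function.comp_apply, Pi.zero_apply] at e1 e2 e3
    generalize (σ' i).2 j = b at e3 ⊢
    rcases b with _ | _ | _ <;> simp [Checked] at e3 ⊢ <;> omega
  obtain ⟨m, hm, -, hv⟩ :=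
    (h2 i).1.validTrace (h2 i).2 0 (fun j _ => hc j) (by simp) (by simp)
  obtain rfl : m = 0 := by simpa using hm
  exact hv

theorem generates_step {A B : CheckNonterminal Q Γ k C N} {α β : List Γ} {w u : List T}
    {p : IndexedProduction T (CheckNonterminal Q Γ k C N) Γ}
    {c n : Fin k × Fin C × Bool → ℕ} {n' : Fin (numCheckCounters k C) → ℕ}
    (hp : M.CheckProduction p c) (ha : p.Applies A α β)
    (hr : p.rhs = rightLinearWord w (some B))
    (h : (M.checkGrammar C N hN).Generates B β ((n + c) ∘ (checkIndex k C).symm) u n') :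
    (M.checkGrammar C N hN).Generates A α (n ∘ (checkIndex k C).symm) (w ++ u) n' :=
  .step (p := (p, c ∘ (checkIndex k C).symm))
    (by simpa [checkGrammar, Function.comp_assoc] using hp) ha hr h

/-- Only 0/1 vectors are available as productions. Splitting `D` into `min D 1` and `D - 1` keeps
equalities and inequalities between entries, so both parts are again paddings. -/
theorem generates_padding (m : ℕ) {st : Fin k → Fin C → Option Bool} (α : List Γ)
    {D : Fin k × Fin C × Bool → ℕ} (n : Fin k × Fin C × Bool → ℕ) (hD : IsPadding st D)
    (hm : ∀ x, D x ≤ m) : (M.checkGrammar C N hN).Generates (.inr st) α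
      (n ∘ (checkIndex k C).symm) [] ((n + D) ∘ (checkIndex k C).symm) := by
  induction m generalizing n D with
  | zero =>
    obtain rfl : D = 0 := funext fun x => by simpa using hm x
    have := CounterIndexedGrammar.Generates.halt (G := M.checkGrammar C N hN) (α := α) (w := [])
      (n := n ∘ (checkIndex k C).symm) (p := (_, 0))
      (show M.CheckProduction _ ((0 : Fin (numCheckCounters k C) → ℕ) ∘ checkIndex k C) from .halt st) (.rewrite _ _ α) rfl
    simpa using this
  | succ m ih =>
    have := ih (D := fun x => D x - 1) (n := n + fun x => min (D x) 1) (fun i j => by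
      have := hD i j
      generalize st i j = b at this ⊢
      rcases b with _ | _ | _ <;> simp [Checked] at this ⊢ <;> omega)
      (fun x => by have := hm x; simp; omega)
    rw [show n + D = (n + fun x => min (D x) 1) + fun x => D x - 1 from funext fun x => by
      simp; omega]
    refine generates_step (w := []) (.pad (fun x => min_le_right _ _) fun i j => ?_)
      (.rewrite _ _ α) rfl this
    have := hD i j
    generalize st i j = b at this ⊢
    rcases b with _ | _ | _ <;> simp [Checked] at this ⊢ <;> omega

/-- A production pushes one index at a time, so the word waits in the nonterminal. Its head is
pushed first and ends up deepest, whence the reversal. -/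
theorem generates_push {q : Q} {σ : Fin k → CheckState C} {w : List Γ} (h : w.length ≤ N)
    {α : List Γ} {n : Fin k × Fin C × Bool → ℕ} {n' : Fin (numCheckCounters k C) → ℕ} {u : List T}
    (hg : (M.checkGrammar C N hN).Generates (.inl (q, σ, ⟨[], Nat.zero_le N⟩)) (w.reverse ++ α)
      (n ∘ (checkIndex k C).symm) u n') :
    (M.checkGrammar C N hN).Generates (.inl (q, σ, ⟨w, h⟩)) α (n ∘ (checkIndex k C).symm) u n' := by
  induction w generalizing α with
  | nil => exact hg
  | cons f w ih =>
    have h' : w.length ≤ N := (Nat.le_succ _).trans h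
    exact generates_step (w := []) (.push q σ f w h h') (.push _ _ f α) rfl
      (by simpa using ih h' (by simpa using hg))

theorem PushdownRun.generates (hpush : ∀ t ∈ M.transitions, t.push.length ≤ N) {q : Q}
    {u : List T} {α : List Γ} {ts : List (NPCMTransition T Q Γ k)} (h : M.PushdownRun q u α ts)
    {σ σ' : Fin k → CheckState C} {Δ : Fin k → Fin C × Bool → ℕ}
    {D n : Fin k × Fin C × Bool → ℕ} (hr : ∀ i, CheckRun (σ i) (trace i ts) (Δ i) (σ' i))
    (hσ' : ∀ i, (σ' i).1 ≠ -1) (hD : IsPadding (fun i => (σ' i).2) D) :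
    (M.checkGrammar C N hN).Generates (.inl (q, σ, ⟨[], Nat.zero_le N⟩)) α
      (n ∘ (checkIndex k C).symm) u
      ((fun x => n x + Δ x.1 x.2 + D x) ∘ (checkIndex k C).symm) := by
  induction h generalizing σ Δ n with
  | @nil q hq α =>
    have key : ∀ i, σ i = σ' i ∧ Δ i = 0 := fun i => by
      have h := hr i
      generalize hs : σ i = s at h
      generalize hs' : σ' i = s' at h
      generalize hd : Δ i = δ at h
      cases h
      exact ⟨rfl, rfl⟩
    obtain rfl : σ = σ' := funext fun i => (key i).1
    refine generates_step (w := []) (.finish hq hσ') (.rewrite _ _ α) rfl ?_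
    have hn : (fun x => n x + Δ x.1 x.2 + D x) = n + D := funext fun x => by simp [key]
    rw [hn]
    simpa using generates_padding (∑ x, D x) α n hD fun x =>
      Finset.single_le_sum (f := D) (fun _ _ => Nat.zero_le _) (Finset.mem_univ x)
  | @cons t u α ts ht _ ih =>
    have key : ∀ i, ∃ s c Δ', CheckStep (σ i) (t.isZero i, t.delta i) c s ∧
        CheckRun s (trace i ts) Δ' (σ' i) ∧ Δ i = c + Δ' := fun i => by
      have h := hr i
      simp only [trace, List.map_cons] at h
      generalize hs : σ i = s at h
      generalize hs' : σ' i = s' at h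
      generalize hd : Δ i = δ at h
      generalize htr : (ts.map fun t => (t.isZero i, t.delta i)) = tr at h
      cases h with
      | cons h h' => exact ⟨_, _, _, h, by rw [trace, htr]; exact h', rfl⟩
    choose σ₁ c Δ' h1 h2 h3 using key
    have hl : t.push.reverse.length ≤ N := by simpa using hpush t ht
    refine generates_step (.move ht (c := fun x => c x.1 x.2) h1 hl) (.pop _ _ _ α) rfl
      (generates_push hl ?_)
    rw [List.reverse_reverse]
    convert ih h2 using 2
    ext x
    simp [h3]
    ring

theorem mem_checkGrammar_of_mem_language (hpush : ∀ t ∈ M.transitions, t.push.length ≤ N)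
    (hM : M.IsReversalBounded C) {u : List T} (hu : u ∈ M.language) :
    u ∈ (M.checkGrammar C N hN).language := by
  obtain ⟨ts, hts⟩ := hu
  have hrev := hM u ts hts
  obtain ⟨c, hc, hi, hs⟩ := hts
  obtain ⟨h1, h2⟩ := hc.pushdownRun hi hs
  have key : ∀ i, Confirms (C := C) (0, fun _ => none) (trace i ts) 0 := fun i =>
    (confirms_of_validTrace (trace i ts) 0 0 (h2 i)).1 rfl _ (by
      simpa [trace, numFree, Function.comp_def, counterReversals] using hrev i)
  -- The sum of all recorded values bounds each of them and serves as the common final value; the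
  -- padding is what is missing to it.
  choose Δ σ' h3 h4 h5 using key
  have hle : ∀ x : Fin k × Fin C × Bool, Δ x.1 x.2 ≤ ∑ x : Fin k × Fin C × Bool, Δ x.1 x.2 :=
    fun x => Finset.single_le_sum (f := fun x : Fin k × Fin C × Bool => Δ x.1 x.2)
      (fun _ _ => Nat.zero_le _) (Finset.mem_univ x)
  generalize ∑ x : Fin k × Fin C × Bool, Δ x.1 x.2 = S at hle
  refine (CounterIndexedGrammar.mem_language_iff checkGrammar_isRightLinear).2
    ⟨fun _ => S, ?_, fun _ _ => rfl⟩
  have := h1.generates (hN := hN) hpush (n := 0) (D := fun x => S - Δ x.1 x.2) h3 h4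
    (fun i j => by
      have e1 := h5 i j rfl
      have e2 := hle (i, j, true)
      have e3 := hle (i, j, false)
      dsimp only at e2 e3 ⊢
      generalize (σ' i).2 j = b at e1 ⊢
      rcases b with _ | _ | _ <;> simp [Checked] at e1 ⊢ <;> omega)
  refine generates_push (w := [M.bottom]) (α := []) hN (n := 0) ?_
  have hS : (fun _ => S) = (fun x : Fin k × Fin C × Bool =>
      (0 : Fin k × Fin C × Bool → ℕ) x + Δ x.1 x.2 + (S - Δ x.1 x.2)) ∘ (checkIndex k C).symm :=
    funext fun x => by
      have := hle ((checkIndex k C).symm x)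
      simp
      omega
  rw [hS]
  exact this

end Simulation

end CounterPDA

theorem Language.IsNPCM.isRightLinearIndexedWithCounters {T : Type u} [Finite T]
    {L : Language T} (h : L.IsNPCM) : L.IsRightLinearIndexedWithCounters := by
  obtain ⟨k, l, Q, Γ, hQ, hΓ, M, hM, rfl⟩ := h
  obtain ⟨N, hN⟩ := (M.finite_transitions.image fun t => t.push.length).bddAbove
  -- The bound is raised by one because the start nonterminal has to hold the bottom symbol.
  have hpush : ∀ t ∈ M.transitions, t.push.length ≤ N + 1 := fun t ht =>
    (hN ⟨t, ht, rfl⟩).trans (Nat.le_succ N)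
  refine ⟨_, _, Γ, inferInstance, hΓ, M.checkGrammar l (N + 1) (Nat.le_add_left 1 N),
    CounterPDA.checkGrammar_isRightLinear, ?_⟩
  ext u
  exact ⟨CounterPDA.mem_language_of_mem_checkGrammar,
    CounterPDA.mem_checkGrammar_of_mem_language hpush hM⟩

theorem mainTheorem6 {T : Type u} [Finite T] (L : Language T) :
    L.IsRightLinearIndexedWithCounters ↔ L.IsNPCM :=
  ⟨fun h => h.isNPCM, fun h => h.isRightLinearIndexedWithCounters⟩
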